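/- **Setting.** A seller with private value $c\sim G$ holds one item; a buyer has private value $v\sim F$; $v,c$ are independent. $F$ and $G$ are probability distributions on $[0,\infty)$ with bounded support; $F$ has a density except for a possible atom at $\bar v=\max\mathrm{supp}(F)$, and $G$ has a density except for a possible atom at $\min\mathrm{supp}(G)$. The buyer's distribution is MHR if, with $F(t)=\Pr[v<t]$, the hazard rate $F'(t)/(1-F(t))$ is non-decreasing between the smallest and the largest value of $\mathrm{supp}(F)$ (wherever $F'$ exists); the seller's distribution is MHR if the random variable $\bar c-c$ is MHR in this sense, where $\bar c=\max\mathrm{supp}(G)$. A mechanism $M=(x,p,\tilde p)$ consists of measurable rules mapping the reports $(v,c)\in[0,\infty)^2$ to an allocation $x\in[0,1]$, a buyer payment $p\ge 0$ and a seller receipt $\tilde p\ge 0$ (with finite expected payments). Let $\mathfrak M$ be the set of mechanisms that are Bayesian incentive compatible, interim individually rational, and ex ante weakly budget balanced ($\mathbb E[p]\ge\mathbb E[\tilde p]$). For a truthfully played mechanism put $U(M)=\mathbb E[v\,x-p]$, $\Pi(M)=\mathbb E[\tilde p-c\,x]$, $\mathrm{GFT}(M)=\mathbb E[(v-c)\,x]$,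 and let $U^*,\Pi^*,\mathrm{OPT}_{SB}$ be the suprema of $U,\Pi,\mathrm{GFT}$ over $\mathfrak M$, and $\mathrm{OPT}_{FB}=\mathbb E[\max\{v-c,0\}]$. A mechanism $M\in\mathfrak M$ is KS-fair if $\Pi(M)/\Pi^*=U(M)/U^*$ (both sides are read as $0$ when no gains from trade are possible, in which case $\Pi^*=U^*=0$). In the Seller Offer Mechanism a seller with value $c$ posts a price $r\ge 0$ maximizing $(r-c)\Pr[v\ge r]$, and trade occurs at price $r$ iff $v\ge r$; in the Buyer Offer Mechanism a buyer with value $v$ posts a price $b\ge 0$ maximizing $(v-b)\Pr[c\le b]$, and trade occurs at price $b$ iff $c\le b$. The $\lambda$-Biased Random Offer Mechanism runs the Seller Offer Mechanism with probability $\lambda$ and the Buyer Offer Mechanism with probability $1-\lambda$. **Statement.** Suppose that $F$ and $G$ are both MHR. Then measurable optimal price choices for the seller and for the buyer exist, and for any such choices there is $\lambda\in[0,1]$ such that the $\lambda$-Biased Random Offer Mechanism $M_\lambda$ is KS-fair (in particular $M_\lambda\in\mathfrak M$) and $$\mathrm{GFT}(M_\lambda)\ \ge\ \tfrac{1}{e-1}\,\mathrm{OPT}_{SB}\qquad\text{and}\qquad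 \mathrm{GFT}(M_\lambda)\ \ge\ \tfrac{1}{e-1}\,\mathrm{OPT}_{FB}.$$ -/

import Mathlib

open MeasureTheory Set

noncomputable section

namespace BilateralTrade

/-! ### Prior distributions -/

/-- Admissible valuation distribution of the buyer: bounded nonnegative support, and the
distribution has a density with respect to Lebesgue measure (in particular no atoms) except for a
possible atom at the largest value of its support. -/
structure IsBuyerPrior (F : Measure ℝ) : Prop where
  isProbability : IsProbabilityMeasure F
  support_nonneg : F.support ⊆ Ici 0
  support_bddAbove : BddAbove F.support
  absolutelyContinuous : F.restrict {sSup F.support}ᶜ ≪ volume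

/-- Admissible valuation distribution of the seller: bounded nonnegative support, and the
distribution has a density with respect to Lebesgue measure (in particular no atoms) except for a
possible atom at the smallest value of its support. -/
structure IsSellerPrior (G : Measure ℝ) : Prop where
  isProbability : IsProbabilityMeasure G
  support_nonneg : G.support ⊆ Ici 0
  support_bddAbove : BddAbove G.support
  absolutelyContinuous : G.restrict {sInf G.support}ᶜ ≪ volume

/-- The left-continuous distribution function `t ↦ Pr[v < t]` of a buyer's value. -/
def buyerCDF (F : Measure ℝ) (t : ℝ) : ℝ := F.real (Iio t)

/-- The hazard rate `F'(v) / (1 - F(v))`. -/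
def hazardRate (F : Measure ℝ) (v : ℝ) : ℝ := deriv (buyerCDF F) v / (1 - buyerCDF F v)

/-- Monotone hazard rate for the buyer: the hazard rate is non-decreasing (wherever the density
`F'` exists) between the smallest and the largest value of the support. -/
def IsBuyerMHR (F : Measure ℝ) : Prop :=
  MonotoneOn (hazardRate F)
    {v | v ∈ Ioo (sInf F.support) (sSup F.support) ∧ DifferentiableAt ℝ (buyerCDF F) v}

/-- Monotone hazard rate for the seller: with `C` the largest value of the support of `G` and
`c` distributed as `G`, the random variable `C - c` has a monotone hazard rate. -/
def IsSellerMHR (G : Measure ℝ) : Prop :=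
  IsBuyerMHR (G.map fun c => sSup G.support - c)

/-! ### Mechanisms -/

/-- A direct-revelation mechanism. The arguments are the reports `v` of the buyer and `c` of the
seller, in this order. Reports are nonnegative reals; values of the rules at other arguments play
no role. -/
structure Mechanism where
  /-- fraction of the item (or probability) transferred to the buyer -/
  alloc : ℝ → ℝ → ℝ
  /-- payment made by the buyer -/
  pay : ℝ → ℝ → ℝ
  /-- payment received by the seller -/
  receive : ℝ → ℝ → ℝ
  measurable_alloc : Measurable (Function.uncurry alloc)
  measurable_pay : Measurable (Function.uncurry pay)
  measurable_receive : Measurable (Function.uncurry receive)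
  alloc_mem : ∀ v c, 0 ≤ v → 0 ≤ c → alloc v c ∈ Icc (0 : ℝ) 1
  pay_nonneg : ∀ v c, 0 ≤ v → 0 ≤ c → 0 ≤ pay v c
  receive_nonneg : ∀ v c, 0 ≤ v → 0 ≤ c → 0 ≤ receive v c

namespace Mechanism

/-- Interim utility of a buyer with value `v` who reports `v'` while the seller is truthful. -/
def buyerInterim (M : Mechanism) (G : Measure ℝ) (v v' : ℝ) : ℝ :=
  ∫ c, (v * M.alloc v' c - M.pay v' c) ∂G

/-- Interim utility of a seller with value `c` who reports `c'` while the buyer is truthful. -/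
def sellerInterim (M : Mechanism) (F : Measure ℝ) (c c' : ℝ) : ℝ :=
  ∫ v, (M.receive v c' - c * M.alloc v c') ∂F

/-- Ex ante utility of the buyer. -/
def buyerUtility (M : Mechanism) (F G : Measure ℝ) : ℝ := ∫ v, M.buyerInterim G v v ∂F

/-- Ex ante utility of the seller. -/
def sellerUtility (M : Mechanism) (F G : Measure ℝ) : ℝ := ∫ c, M.sellerInterim F c c ∂G

/-- Expected gains from trade. -/
def gft (M : Mechanism) (F G : Measure ℝ) : ℝ :=
  ∫ z, (z.1 - z.2) * M.alloc z.1 z.2 ∂(F.prod G)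

/-- All expected payments entering the utilities exist: the interim one after every report, and
the ex ante one. -/
structure HasExpectedPayments (M : Mechanism) (F G : Measure ℝ) : Prop where
  pay_interim : ∀ v, 0 ≤ v → Integrable (fun c => M.pay v c) G
  receive_interim : ∀ c, 0 ≤ c → Integrable (fun v => M.receive v c) F
  pay_exAnte : Integrable (Function.uncurry M.pay) (F.prod G)
  receive_exAnte : Integrable (Function.uncurry M.receive) (F.prod G)

/-- Bayesian incentive compatibility: truthful reporting is a Bayesian Nash equilibrium. -/
structure IsBIC (M : Mechanism) (F G : Measure ℝ) : Prop where
  buyer : ∀ v ∈ F.support, ∀ v', 0 ≤ v' → M.buyerInterim G v v' ≤ M.buyerInterim G v v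
  seller : ∀ c ∈ G.support, ∀ c', 0 ≤ c' → M.sellerInterim F c c' ≤ M.sellerInterim F c c

/-- Interim individual rationality. -/
structure IsIIR (M : Mechanism) (F G : Measure ℝ) : Prop where
  buyer : ∀ v ∈ F.support, 0 ≤ M.buyerInterim G v v
  seller : ∀ c ∈ G.support, 0 ≤ M.sellerInterim F c c

/-- Ex ante weak budget balance. -/
def IsWBB (M : Mechanism) (F G : Measure ℝ) : Prop :=
  ∫ c, ∫ v, M.receive v c ∂F ∂G ≤ ∫ v, ∫ c, M.pay v c ∂G ∂F

/-- The mechanism that runs `M` with probability `t` and `N` with probability `1 - t`. -/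
def mix (t : unitInterval) (M N : Mechanism) : Mechanism where
  alloc v c := t * M.alloc v c + (1 - t) * N.alloc v c
  pay v c := t * M.pay v c + (1 - t) * N.pay v c
  receive v c := t * M.receive v c + (1 - t) * N.receive v c
  measurable_alloc := (M.measurable_alloc.const_mul _).add (N.measurable_alloc.const_mul _)
  measurable_pay := (M.measurable_pay.const_mul _).add (N.measurable_pay.const_mul _)
  measurable_receive := (M.measurable_receive.const_mul _).add (N.measurable_receive.const_mul _)
  alloc_mem v c hv hc := (convex_Icc (0 : ℝ) 1) (M.alloc_mem v c hv hc) (N.alloc_mem v c hv hc)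
    t.2.1 (sub_nonneg.2 t.2.2) (by ring)
  pay_nonneg v c hv hc := add_nonneg (mul_nonneg t.2.1 (M.pay_nonneg v c hv hc))
    (mul_nonneg (sub_nonneg.2 t.2.2) (N.pay_nonneg v c hv hc))
  receive_nonneg v c hv hc := add_nonneg (mul_nonneg t.2.1 (M.receive_nonneg v c hv hc))
    (mul_nonneg (sub_nonneg.2 t.2.2) (N.receive_nonneg v c hv hc))

end Mechanism

/-- The mechanisms that are BIC, interim individually rational and ex ante weakly budget
balanced. -/
def admissible (F G : Measure ℝ) : Set Mechanism :=
  {M | M.HasExpectedPayments F G ∧ M.IsBIC F G ∧ M.IsIIR F G ∧ M.IsWBB F G}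

/-! ### Benchmarks and fairness -/

/-- First-best benchmark `E[(v - c)⁺]`. -/
def optFB (F G : Measure ℝ) : ℝ := ∫ z, max 0 (z.1 - z.2) ∂(F.prod G)

/-- Second-best benchmark: the optimal gains from trade over all admissible mechanisms. -/
def optSB (F G : Measure ℝ) : ℝ := sSup ((fun M => M.gft F G) '' admissible F G)

/-- The seller's ideal utility. -/
def sellerIdeal (F G : Measure ℝ) : ℝ := sSup ((fun M => M.sellerUtility F G) '' admissible F G)

/-- The buyer's ideal utility. -/
def buyerIdeal (F G : Measure ℝ) : ℝ := sSup ((fun M => M.buyerUtility F G) '' admissible F G)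

/-- KS-fairness. (If no gains from trade are possible, both ideal utilities vanish, and so do both
sides of the equation.) -/
structure IsKSFair (M : Mechanism) (F G : Measure ℝ) : Prop where
  mem_admissible : M ∈ admissible F G
  fair : M.sellerUtility F G / sellerIdeal F G = M.buyerUtility F G / buyerIdeal F G

/-! ### Offer mechanisms -/

/-- An optimal way for the seller to choose a take-it-or-leave-it price `price c` given her realized
value `c`: the price maximizes `(p - c) * Pr[v ≥ p]` over `p ≥ 0`. -/
structure SellerOffer (F G : Measure ℝ) where
  /-- the price offered by a seller with value `c` -/
  price : ℝ → ℝ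
  measurable_price : Measurable price
  price_nonneg : ∀ c, 0 ≤ c → 0 ≤ price c
  optimal : ∀ c ∈ G.support, IsMaxOn (fun p => (p - c) * F.real (Ici p)) (Ici 0) (price c)

/-- An optimal way for the buyer to choose a take-it-or-leave-it price `price v` given her realized
value `v`: the price maximizes `(v - p) * Pr[c ≤ p]` over `p ≥ 0`. -/
structure BuyerOffer (F G : Measure ℝ) where
  /-- the price offered by a buyer with value `v` -/
  price : ℝ → ℝ
  measurable_price : Measurable price
  price_nonneg : ∀ v, 0 ≤ v → 0 ≤ price v
  optimal : ∀ v ∈ F.support, IsMaxOn (fun p => (v - p) * G.real (Iic p)) (Ici 0) (price v)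

open Classical in
/-- The Seller Offer Mechanism: trade at the seller's price iff the buyer's value is at least this
price. -/
def SellerOffer.mechanism {F G : Measure ℝ} (s : SellerOffer F G) : Mechanism where
  alloc v c := if s.price c ≤ v then 1 else 0
  pay v c := if s.price c ≤ v then s.price c else 0
  receive v c := if s.price c ≤ v then s.price c else 0
  measurable_alloc := Measurable.ite
    (measurableSet_le (s.measurable_price.comp measurable_snd) measurable_fst)
    measurable_const measurable_const
  measurable_pay := Measurable.ite
    (measurableSet_le (s.measurable_price.comp measurable_snd) measurable_fst)
    (s.measurable_price.comp measurable_snd) measurable_const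
  measurable_receive := Measurable.ite
    (measurableSet_le (s.measurable_price.comp measurable_snd) measurable_fst)
    (s.measurable_price.comp measurable_snd) measurable_const
  alloc_mem v c _ _ := by split_ifs <;> simp
  pay_nonneg v c _ hc := by
    split_ifs
    exacts [s.price_nonneg c hc, le_rfl]
  receive_nonneg v c _ hc := by
    split_ifs
    exacts [s.price_nonneg c hc, le_rfl]

open Classical in
/-- The Buyer Offer Mechanism: trade at the buyer's price iff the seller's value is at most this
price. -/
def BuyerOffer.mechanism {F G : Measure ℝ} (b : BuyerOffer F G) : Mechanism where
  alloc v c := if c ≤ b.price v then 1 else 0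
  pay v c := if c ≤ b.price v then b.price v else 0
  receive v c := if c ≤ b.price v then b.price v else 0
  measurable_alloc := Measurable.ite
    (measurableSet_le measurable_snd (b.measurable_price.comp measurable_fst))
    measurable_const measurable_const
  measurable_pay := Measurable.ite
    (measurableSet_le measurable_snd (b.measurable_price.comp measurable_fst))
    (b.measurable_price.comp measurable_fst) measurable_const
  measurable_receive := Measurable.ite
    (measurableSet_le measurable_snd (b.measurable_price.comp measurable_fst))
    (b.measurable_price.comp measurable_fst) measurable_const
  alloc_mem v c _ _ := by split_ifs <;> simp
  pay_nonneg v c hv _ := by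
    split_ifs
    exacts [b.price_nonneg v hv, le_rfl]
  receive_nonneg v c hv _ := by
    split_ifs
    exacts [b.price_nonneg v hv, le_rfl]

/-- The `t`-Biased Random Offer Mechanism: the Seller Offer Mechanism with probability `t`, the
Buyer Offer Mechanism with probability `1 - t`. -/
def biasedRandomOffer {F G : Measure ℝ} (t : unitInterval) (s : SellerOffer F G)
    (b : BuyerOffer F G) : Mechanism :=
  Mechanism.mix t s.mechanism b.mechanism

end BilateralTrade

end

open BilateralTrade

open Filter Topology

/-! Write S(t) = Pr[v ≥ t]. A monotone hazard rate makes S log-concave: at each point below the top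
of the support, S lies under an exponential touching it there (`isLogConcaveSurv`). Let r be an
optimal price for a seller with cost c. Optimality bounds the slope of these exponentials just below
r, and in the limit S(t) ≤ S(r) exp((r - t)/(r - c)) for t < r (`surv_le_exp`). Integrating over [c,
r] gives at most (e - 1)(r - c)S(r). All gains from trade at cost c are the integral of S over [c,
∞), while those realized at price r are (r - c)S(r) plus the integral over [r, ∞). So the Seller
Offer Mechanism has at least the fraction 1/(e - 1) of the first best (`integral_max_sub_le`).

The seller's ideal is attained by the same mechanism, by Myerson's argument. Incentive compatibility
forces information rents (`payment_le`), which turns payments net of cost into virtual surplus. By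
the same slope comparison, virtual value minus cost changes sign at r, so posting r is optimal among
all allocation rules (`virtual_surplus_le`, `revenue_le`).

The reflection c ↦ C - c exchanges the two sides of the market: a buyer offering b to a seller
becomes a seller posting C - b. Hence both conclusions hold for the Buyer Offer Mechanism too.

Gains from trade are linear in the mixing weight, so every biased mixture keeps the bound. Fairness
is one linear equation for the weight, solvable in [0, 1] because each offer mechanism is ideal for
its proposer (`exists_unitInterval_div_eq`). -/

theorem AbsolutelyContinuousOnInterval.congr_uIcc {f g : ℝ → ℝ} {a b : ℝ}
    (hf : AbsolutelyContinuousOnInterval f a b) (hfg : EqOn f g (uIcc a b)) :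
    AbsolutelyContinuousOnInterval g a b := by
  refine Tendsto.congr' ?_ hf
  rw [EventuallyEq, eventually_inf_principal]
  refine Eventually.of_forall fun E hE => Finset.sum_congr rfl fun i hi => ?_
  rw [hfg (hE.1 i hi).1, hfg (hE.1 i hi).2]

/-! ### Survival function and density of a bounded prior. -/

namespace BilateralTrade

/-- A value distribution with bounded support that has a density except for a possible atom at the
largest value of its support. -/
structure IsBoundedPrior (μ : Measure ℝ) : Prop where
  isProbability : IsProbabilityMeasure μ
  bddBelow : BddBelow μ.support
  bddAbove : BddAbove μ.support
  absolutelyContinuous : μ.restrict {sSup μ.support}ᶜ ≪ volume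

/-- The survival function `t ↦ Pr[v ≥ t]`. -/
noncomputable def surv (μ : Measure ℝ) (t : ℝ) : ℝ := μ.real (Ici t)

/-- The density of the part of `μ` below its largest value. -/
noncomputable def density (μ : Measure ℝ) (t : ℝ) : ℝ :=
  ((μ.restrict {sSup μ.support}ᶜ).rnDeriv volume t).toReal

/-- The survival function is log-concave: below the top of the support, it has a supporting
exponential at each point. -/
def IsLogConcaveSurv (μ : Measure ℝ) : Prop :=
  ∀ y < sSup μ.support, ∃ k, 0 ≤ k ∧ ∀ t, surv μ t ≤ surv μ y * Real.exp (k * (y - t))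

variable {μ : Measure ℝ}

theorem surv_antitone [IsFiniteMeasure μ] : Antitone (surv μ) := fun _ _ h =>
  measureReal_mono (Ici_subset_Ici.2 h)

theorem surv_nonneg (t : ℝ) : 0 ≤ surv μ t := measureReal_nonneg

theorem surv_le_one [IsProbabilityMeasure μ] (t : ℝ) : surv μ t ≤ 1 := measureReal_le_one

theorem measurable_surv [IsFiniteMeasure μ] : Measurable (surv μ) := surv_antitone.measurable

theorem surv_eq_one_sub [IsProbabilityMeasure μ] (t : ℝ) : surv μ t = 1 - buyerCDF μ t := by
  rw [surv, buyerCDF, ← compl_Iio, probReal_compl_eq_one_sub measurableSet_Iio]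

theorem surv_sub_surv [IsFiniteMeasure μ] {x y : ℝ} (h : x ≤ y) :
    surv μ x - surv μ y = μ.real (Ico x y) := by
  have : Ici x = Ico x y ∪ Ici y := (Ico_union_Ici_eq_Ici h).symm
  rw [surv, surv, this, measureReal_union _ measurableSet_Ici]
  · ring
  · exact Set.disjoint_left.2 fun z hz hz' => not_lt.2 hz' hz.2

namespace IsBoundedPrior

variable (h : IsBoundedPrior μ)

include h

theorem ae_mem_Icc : ∀ᵐ v ∂μ, v ∈ Icc (sInf μ.support) (sSup μ.support) := by
  filter_upwards [Measure.support_mem_ae (μ := μ)] with v hv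
  exact ⟨csInf_le h.bddBelow hv, le_csSup h.bddAbove hv⟩

theorem support_nonempty : μ.support.Nonempty := by
  have := h.isProbability
  exact Measure.nonempty_support (IsProbabilityMeasure.ne_zero μ)

theorem sInf_mem : sInf μ.support ∈ μ.support :=
  Measure.isClosed_support.csInf_mem h.support_nonempty h.bddBelow

theorem sSup_mem : sSup μ.support ∈ μ.support :=
  Measure.isClosed_support.csSup_mem h.support_nonempty h.bddAbove

theorem sInf_le_sSup : sInf μ.support ≤ sSup μ.support := csInf_le h.bddBelow h.sSup_mem

theorem surv_eq_one {t : ℝ} (ht : t ≤ sInf μ.support) : surv μ t = 1 := by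
  have := h.isProbability
  have : Ici t ∈ ae μ := by
    filter_upwards [h.ae_mem_Icc] with v hv
    exact ht.trans hv.1
  rw [surv, measureReal_def, mem_ae_iff_prob_eq_one measurableSet_Ici |>.1 this]
  simp

theorem surv_eq_zero {t : ℝ} (ht : sSup μ.support < t) : surv μ t = 0 := by
  have : μ (Ici t) = 0 := by
    rw [measure_eq_zero_iff_ae_notMem]
    filter_upwards [h.ae_mem_Icc] with v hv hv'
    exact absurd (ht.trans_le hv') (not_lt.2 hv.2)
  simp [surv, measureReal_def, this]

theorem surv_pos {t : ℝ} (ht : t < sSup μ.support) : 0 < surv μ t := by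
  have := h.isProbability
  have := (Measure.mem_support_iff_forall _).1 h.sSup_mem (Ici t) (Ici_mem_nhds ht)
  exact ENNReal.toReal_pos this.ne' (measure_ne_top _ _)

theorem surv_lt_one {t : ℝ} (ht : sInf μ.support < t) : surv μ t < 1 := by
  have := h.isProbability
  have h1 := (Measure.mem_support_iff_forall _).1 h.sInf_mem (Iio t) (Iio_mem_nhds ht)
  have : 0 < buyerCDF μ t := ENNReal.toReal_pos h1.ne' (measure_ne_top _ _)
  rw [surv_eq_one_sub]
  linarith

theorem setIntegral_density (g : ℝ → ℝ) {s : Set ℝ} (hs : MeasurableSet s)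
    (hs' : s ⊆ Iio (sSup μ.support)) :
    ∫ t in s, density μ t * g t = ∫ t in s, g t ∂μ := by
  have := h.isProbability
  have h1 := setIntegral_rnDeriv_smul h.absolutelyContinuous (f := g) hs
  rw [Measure.restrict_restrict hs, inter_eq_left.2 (show s ⊆ {sSup μ.support}ᶜ from fun x hx => (hs' hx).ne)] at h1
  simpa [density] using h1

theorem integrable_density : Integrable (density μ) := by
  have := h.isProbability
  exact Measure.integrable_toReal_rnDeriv

theorem integrableOn_density_mul {g : ℝ → ℝ} {s : Set ℝ} (hs : MeasurableSet s)
    (hg : IntegrableOn g s μ) : IntegrableOn (fun t => density μ t * g t) s := by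
  have := h.isProbability
  have h1 := (integrable_rnDeriv_smul_iff (f := s.indicator g) h.absolutelyContinuous).2
    (((integrable_indicator_iff hs).2 hg).mono_measure Measure.restrict_le_self)
  refine h1.integrableOn.congr_fun (fun t ht => ?_) hs
  simp [density, ht]

/-- An atom at the top counts fully in Pr[v ≥ t] for every t up to and including the top, so it
cancels in differences and only the density remains. -/
theorem surv_eq_sub_integral {x y : ℝ} (hx : x ≤ sSup μ.support) (hy : y ≤ sSup μ.support) :
    surv μ y = surv μ x - ∫ t in x..y, density μ t := by
  have := h.isProbability
  have key : ∀ {x y : ℝ}, x ≤ y → y ≤ sSup μ.support →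
      surv μ x - surv μ y = ∫ t in x..y, density μ t := by
    intro x y hxy hy
    rw [surv_sub_surv hxy, intervalIntegral.integral_of_le hxy, ← integral_Ico_eq_integral_Ioc]
    have := h.setIntegral_density (fun _ => 1) (s := Ico x y) measurableSet_Ico
      (fun t ht => ht.2.trans_le hy)
    simpa using this.symm
  rcases le_total x y with hxy | hxy
  · linarith [key hxy hy]
  · rw [intervalIntegral.integral_symm]
    linarith [key hxy hx]

theorem absolutelyContinuousOnInterval_surv {x y : ℝ} (hxy : x ≤ y) (hy : y ≤ sSup μ.support) :
    AbsolutelyContinuousOnInterval (surv μ) x y := by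
  have h1 := (h.integrable_density.intervalIntegrable (a := x)
    (b := y)).absolutelyContinuousOnInterval_intervalIntegral (c := x) (by simp)
  have h2 : AbsolutelyContinuousOnInterval (fun _ : ℝ => surv μ x) x y :=
    (LipschitzWith.const (surv μ x)).lipschitzOnWith.absolutelyContinuousOnInterval
  -- The integral formula is valid only up to the top of the support, hence the need for a
  -- congruence on the interval alone.
  refine (h2.sub h1).congr_uIcc fun t ht => ?_
  rw [uIcc_of_le hxy] at ht
  exact (h.surv_eq_sub_integral (hxy.trans hy) (ht.2.trans hy)).symm

theorem ae_hasDerivAt_surv :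
    ∀ᵐ t, t < sSup μ.support → HasDerivAt (surv μ) (-density μ t) t := by
  filter_upwards [LocallyIntegrable.ae_hasDerivAt_integral
    h.integrable_density.locallyIntegrable] with t ht htV
  have h1 := ht (sSup μ.support)
  have h2 := h1.const_sub (surv μ (sSup μ.support))
  refine h2.congr_of_eventuallyEq ?_
  filter_upwards [Iio_mem_nhds htV] with s hs
  exact h.surv_eq_sub_integral le_rfl (le_of_lt hs)

theorem continuousOn_surv : ContinuousOn (surv μ) (Iic (sSup μ.support)) := by
  intro t ht
  have h1 : t - 1 ≤ sSup μ.support := (sub_le_self t zero_le_one).trans ht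
  have h2 := (h.absolutelyContinuousOnInterval_surv h1 le_rfl).continuousOn
  rw [uIcc_of_le h1] at h2
  refine (h2 t ⟨sub_le_self t zero_le_one, ht⟩).mono_of_mem_nhdsWithin ?_
  filter_upwards [self_mem_nhdsWithin, mem_nhdsWithin_of_mem_nhds (Ioi_mem_nhds (sub_one_lt t))]
    with s hs hs' using ⟨le_of_lt hs', hs⟩

end IsBoundedPrior

/-! ### From a monotone hazard rate to a log-concave survival function. -/

namespace IsBoundedPrior

variable (h : IsBoundedPrior μ)

include h

theorem ae_hasDerivAt_buyerCDF :
    ∀ᵐ t, t < sSup μ.support → HasDerivAt (buyerCDF μ) (density μ t) t := by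
  have := h.isProbability
  filter_upwards [h.ae_hasDerivAt_surv] with t ht htV
  have h1 := (ht htV).const_sub 1
  simp only [neg_neg] at h1
  refine h1.congr_of_eventuallyEq (Eventually.of_forall fun s => ?_)
  simp [surv_eq_one_sub]

theorem ae_density_eq_hazardRate_mul :
    ∀ᵐ t, t < sSup μ.support → density μ t = hazardRate μ t * surv μ t := by
  have := h.isProbability
  filter_upwards [h.ae_hasDerivAt_buyerCDF] with t ht htV
  rw [hazardRate, (ht htV).deriv, ← surv_eq_one_sub, div_mul_cancel₀ _ (h.surv_pos htV).ne']

/-- The fundamental theorem of calculus for the absolutely continuous function S(t)exp(kt). The sign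
of its derivative is that of k minus the hazard rate. -/
theorem surv_mul_exp_sub (k : ℝ) {x z : ℝ} (hxz : x ≤ z) (hz : z ≤ sSup μ.support) :
    ∫ t in Ioo x z, surv μ t * Real.exp (k * t) * (k - hazardRate μ t) =
      surv μ z * Real.exp (k * z) - surv μ x * Real.exp (k * x) := by
  have h1 := h.absolutelyContinuousOnInterval_surv hxz hz
  have hd : ∀ t, HasDerivAt (fun t => Real.exp (k * t)) (Real.exp (k * t) * k) t := fun t => by
    simpa using ((hasDerivAt_id t).const_mul k).exp
  have h2 : AbsolutelyContinuousOnInterval (fun t => Real.exp (k * t)) x z :=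
    ContDiffOn.absolutelyContinuousOnInterval (by fun_prop)
  rw [← h1.integral_deriv_mul_eq_sub h2, intervalIntegral.integral_of_le hxz,
    integral_Ioc_eq_integral_Ioo]
  refine setIntegral_congr_ae measurableSet_Ioo ?_
  filter_upwards [h.ae_hasDerivAt_surv, h.ae_density_eq_hazardRate_mul] with t ht1 ht2 ht
  have htV := ht.2.trans_le hz
  rw [(ht1 htV).deriv, ht2 htV, (hd t).deriv]
  ring

/-- A monotone hazard rate makes the survival function log-concave. -/
theorem isLogConcaveSurv (hm : IsBuyerMHR μ) : IsLogConcaveSurv μ := by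
  have := h.isProbability
  intro y hy
  rcases le_or_gt y (sInf μ.support) with hya | hay
  · exact ⟨0, le_rfl, fun t => by simpa [h.surv_eq_one hya] using surv_le_one t⟩
  set a := sInf μ.support
  set V := sSup μ.support
  set D := {v | v ∈ Ioo a V ∧ DifferentiableAt ℝ (buyerCDF μ) v}
  have hD : ∀ᵐ t, t < V → 0 ≤ hazardRate μ t ∧ (a < t → t ∈ D) := by
    filter_upwards [h.ae_hasDerivAt_buyerCDF, h.ae_density_eq_hazardRate_mul] with t h1 h2 ht
    refine ⟨?_, fun hat => ⟨⟨hat, ht⟩, (h1 ht).differentiableAt⟩⟩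
    have h3 : 0 ≤ density μ t := ENNReal.toReal_nonneg
    rw [h2 ht] at h3
    exact nonneg_of_mul_nonneg_left h3 (h.surv_pos ht)
  -- Differentiability is known only almost everywhere. Density still provides good points on both
  -- sides of `y`: `d` bounds the hazard rates before `y` from above, and `d'` shows that there are
  -- some.
  have hdense := Measure.dense_of_ae hD
  obtain ⟨d, hd, hyd, hdV⟩ := hdense.exists_between hy
  obtain ⟨d', hd', had', hdy'⟩ := hdense.exists_between hay
  have hdD := (hd hdV).2 (hay.trans hyd)
  have hdD' := (hd' (hdy'.trans hy)).2 had'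
  set T := hazardRate μ '' {t | t ∈ D ∧ t < y}
  have hub : ∀ s ∈ D, y < s → hazardRate μ s ∈ upperBounds T := by
    rintro s hs hys _ ⟨t, ⟨ht, hty⟩, rfl⟩
    exact hm ht hs (hty.trans hys).le
  have hT : BddAbove T := ⟨_, hub d hdD hyd⟩
  have hdT : hazardRate μ d' ∈ T := ⟨d', ⟨hdD', hdy'⟩, rfl⟩
  -- With the supremum of the hazard rates before `y` as slope, S(t)exp(kt) increases up to `y` and
  -- decreases afterwards, so its maximum is at `y`.
  set k := sSup T
  have hk : 0 ≤ k := (hd' (hdy'.trans hy)).1.trans (le_csSup hT hdT)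
  have hpos : ∀ t, 0 ≤ surv μ t * Real.exp (k * t) := fun t =>
    mul_nonneg (surv_nonneg t) (Real.exp_pos _).le
  have key : ∀ t, a ≤ t → t ≤ V →
      surv μ t * Real.exp (k * t) ≤ surv μ y * Real.exp (k * y) := by
    intro t hat htV
    rcases le_total t y with hty | hyt
    · rw [← sub_nonneg, ← h.surv_mul_exp_sub k hty hy.le]
      refine setIntegral_nonneg_of_ae_restrict ((ae_restrict_iff' measurableSet_Ioo).2 ?_)
      filter_upwards [hD] with s hs hst
      exact mul_nonneg (hpos s) (sub_nonneg.2 (le_csSup hT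
        ⟨s, ⟨(hs (hst.2.trans hy)).2 (hat.trans_lt hst.1), hst.2⟩, rfl⟩))
    · rw [← sub_nonpos, ← h.surv_mul_exp_sub k hyt htV]
      refine setIntegral_nonpos_of_ae_restrict ((ae_restrict_iff' measurableSet_Ioo).2 ?_)
      filter_upwards [hD] with s hs hst
      exact mul_nonpos_of_nonneg_of_nonpos (hpos s) (sub_nonpos.2 (csSup_le ⟨_, hdT⟩
        (hub s ((hs (hst.2.trans_le htV)).2 (hay.trans hst.1)) hst.1)))
  have key' : ∀ t, a ≤ t → t ≤ V → surv μ t ≤ surv μ y * Real.exp (k * (y - t)) := by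
    intro t hat htV
    rw [mul_sub, Real.exp_sub, mul_div_assoc', le_div_iff₀ (Real.exp_pos _)]
    exact key t hat htV
  refine ⟨k, hk, fun t => ?_⟩
  rcases le_or_gt t V with htV | htV
  · rcases le_or_gt a t with hat | hta
    · exact key' t hat htV
    · rw [h.surv_eq_one hta.le, ← h.surv_eq_one le_rfl]
      refine (key' a le_rfl h.sInf_le_sSup).trans ?_
      have := surv_nonneg (μ := μ) y
      gcongr
  · rw [h.surv_eq_zero htV]
    exact mul_nonneg (surv_nonneg _) (Real.exp_pos _).le

end IsBoundedPrior

/-! ### Optimal prices against a log-concave survival function. -/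

/-- The price `r` maximizes the expected profit `(p - c) * Pr[v ≥ p]` of a seller with cost `c`. -/
def IsOptimalPrice (μ : Measure ℝ) (c r : ℝ) : Prop :=
  ∀ p, (p - c) * surv μ p ≤ (r - c) * surv μ r

namespace IsOptimalPrice

variable {c r : ℝ} (hr : IsOptimalPrice μ c r)

include hr

theorem profit_nonneg : 0 ≤ (r - c) * surv μ r := by simpa using hr c

theorem profit_pos (h : IsBoundedPrior μ) (hc : c < sSup μ.support) :
    0 < (r - c) * surv μ r := by
  obtain ⟨p, hcp, hp⟩ := exists_between hc
  exact (mul_pos (sub_pos.2 hcp) (h.surv_pos hp)).trans_le (hr p)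

theorem surv_pos (h : IsBoundedPrior μ) (hc : c < sSup μ.support) : 0 < surv μ r :=
  (surv_nonneg r).lt_of_ne fun h0 => (hr.profit_pos h hc).ne' (by simp [← h0])

theorem cost_lt (h : IsBoundedPrior μ) (hc : c < sSup μ.support) : c < r :=
  sub_pos.1 (pos_of_mul_pos_left (hr.profit_pos h hc) (surv_nonneg r))

theorem le_sSup (h : IsBoundedPrior μ) (hc : c < sSup μ.support) : r ≤ sSup μ.support :=
  not_lt.1 fun h0 => (hr.surv_pos h hc).ne' (h.surv_eq_zero h0)

theorem sInf_le (h : IsBoundedPrior μ) : sInf μ.support ≤ r := by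
  by_contra! h0
  have := hr (sInf μ.support)
  rw [h.surv_eq_one le_rfl, h.surv_eq_one h0.le] at this
  linarith

/-- Comparison of the slope of a supporting exponential with that of the seller's isoprofit
curve. -/
theorem slope_mul_nonpos (h : IsBoundedPrior μ) {u k : ℝ} (hcu : c < u) (hu : u < sSup μ.support)
    (hk : ∀ t, surv μ t ≤ surv μ u * Real.exp (k * (u - t))) :
    ((u - c) * k - 1) * (r - u) ≤ 0 := by
  have hcr := hr.cost_lt h (hcu.trans hu)
  have h1 : (u - c) * surv μ u ≤ (r - c) * (surv μ u * Real.exp (k * (u - r))) :=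
    (hr u).trans (mul_le_mul_of_nonneg_left (hk r) (sub_pos.2 hcr).le)
  have h2 : (u - c) * Real.exp (k * (r - u)) ≤ r - c := by
    have h3 : u - c ≤ (r - c) * Real.exp (k * (u - r)) :=
      le_of_mul_le_mul_right (by linarith) (h.surv_pos hu)
    have h4 : Real.exp (k * (u - r)) * Real.exp (k * (r - u)) = 1 := by
      rw [← Real.exp_add]; ring_nf; simp
    calc _ ≤ (r - c) * Real.exp (k * (u - r)) * Real.exp (k * (r - u)) := by gcongr
      _ = r - c := by rw [mul_assoc, h4, mul_one]
  -- Linearizing the exponential in `h2` gives (u - c)(1 + k(r - u)) ≤ r - c, which rearranges to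
  -- the claim.
  have h5 := mul_le_mul_of_nonneg_left (Real.add_one_le_exp (k * (r - u))) (sub_pos.2 hcu).le
  linarith

/-- At `u` just below `r`, a supporting exponential has slope at most 1/(u - c), and optimality
gives S(u) ≤ S(r)(r - c)/(u - c). The bound follows as `u` tends to `r`. Working at `r` itself is
not possible, since `r` may be the top of the support, where no supporting exponential is assumed.
-/
theorem surv_le_exp (h : IsBoundedPrior μ) (hlc : IsLogConcaveSurv μ) (hc : c < sSup μ.support)
    {t : ℝ} (htr : t < r) : surv μ t ≤ surv μ r * Real.exp ((r - t) / (r - c)) := by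
  have hcr := hr.cost_lt h hc
  have hrV := hr.le_sSup h hc
  have hlim : Tendsto (fun u => surv μ r * ((r - c) / (u - c) * Real.exp ((u - t) / (u - c))))
      (𝓝[<] r) (𝓝 (surv μ r * ((r - c) / (r - c) * Real.exp ((r - t) / (r - c))))) := by
    refine ContinuousAt.tendsto (f := fun u =>
      surv μ r * ((r - c) / (u - c) * Real.exp ((u - t) / (u - c)))) ?_ |>.mono_left
        nhdsWithin_le_nhds
    have : r - c ≠ 0 := (sub_pos.2 hcr).ne'
    fun_prop (disch := assumption)
  rw [div_self (sub_pos.2 hcr).ne', one_mul] at hlim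
  refine ge_of_tendsto hlim ?_
  filter_upwards [Ioo_mem_nhdsLT (max_lt hcr htr)] with u hu
  have hcu := (le_max_left _ _).trans_lt hu.1
  have htu := (le_max_right _ _).trans_lt hu.1
  have hu' : 0 < u - c := sub_pos.2 hcu
  obtain ⟨k, hk0, hk⟩ := hlc u (hu.2.trans_le hrV)
  have h1 := hr.slope_mul_nonpos h hcu (hu.2.trans_le hrV) hk
  have h2 : (u - c) * k ≤ 1 := by nlinarith [hu.2]
  have h3 : k ≤ 1 / (u - c) := by rw [le_div_iff₀ hu']; linarith
  have h4 : surv μ u ≤ surv μ r * ((r - c) / (u - c)) := by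
    rw [mul_div_assoc', le_div_iff₀ hu']
    linarith [hr u]
  calc surv μ t ≤ surv μ u * Real.exp (k * (u - t)) := hk t
    _ ≤ surv μ r * ((r - c) / (u - c)) * Real.exp (1 / (u - c) * (u - t)) := by
      have : 0 ≤ u - t := by linarith
      have := (surv_nonneg (μ := μ) u).trans h4
      gcongr
    _ = _ := by rw [mul_assoc, one_div_mul_eq_div]

theorem intervalIntegral_surv_le (h : IsBoundedPrior μ) (hlc : IsLogConcaveSurv μ)
    (hc : c < sSup μ.support) :
    ∫ t in c..r, surv μ t ≤ (Real.exp 1 - 1) * ((r - c) * surv μ r) := by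
  have := h.isProbability
  have hcr := hr.cost_lt h hc
  have hne : r - c ≠ 0 := (sub_pos.2 hcr).ne'
  have hint : ∫ t in c..r, surv μ r * Real.exp ((r - t) / (r - c)) =
      (Real.exp 1 - 1) * ((r - c) * surv μ r) := by
    have hd : ∀ t ∈ uIcc c r, HasDerivAt
        (fun t => -(r - c) * surv μ r * Real.exp ((r - t) / (r - c)))
        (surv μ r * Real.exp ((r - t) / (r - c))) t := fun t _ => by
      have h1 := ((((hasDerivAt_id t).const_sub r).div_const (r - c)).exp).const_mul
        (-(r - c) * surv μ r)
      refine h1.congr_deriv ?_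
      simp only [id]; field_simp
    rw [intervalIntegral.integral_eq_sub_of_hasDerivAt hd
      (Continuous.intervalIntegrable (by fun_prop) _ _)]
    simp [div_self hne]
    ring
  rw [← hint]
  refine intervalIntegral.integral_mono_on_of_le_Ioo hcr.le
    surv_antitone.intervalIntegrable (Continuous.intervalIntegrable (by fun_prop) _ _) ?_
  exact fun t ht => hr.surv_le_exp h hlc hc ht.2

end IsOptimalPrice

/-! ### Gains from trade at an optimal price. -/

namespace IsBoundedPrior

variable (h : IsBoundedPrior μ)

include h

theorem integrable_of_bound {g : ℝ → ℝ} (hg : AEStronglyMeasurable g μ) (K : ℝ)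
    (hK : ∀ v ∈ Icc (sInf μ.support) (sSup μ.support), |g v| ≤ K) : Integrable g μ := by
  have := h.isProbability
  refine Integrable.of_bound hg K ?_
  filter_upwards [h.ae_mem_Icc] with v hv using hK v hv

theorem integrable_of_continuous {g : ℝ → ℝ} (hg : Continuous g) : Integrable g μ := by
  obtain ⟨K, hK⟩ := isCompact_Icc.exists_bound_of_continuousOn
    (s := Icc (sInf μ.support) (sSup μ.support)) hg.continuousOn
  exact h.integrable_of_bound hg.aestronglyMeasurable K hK

/-- The difference of the positive parts is the length of the part of (c, r] below `v`. Fubini turns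
its mean into an integral of Pr[v ≥ t]. -/
theorem integral_max_sub {c r : ℝ} (hcr : c ≤ r) :
    ∫ v, max 0 (v - c) ∂μ = ∫ v, max 0 (v - r) ∂μ + ∫ t in c..r, surv μ t := by
  have := h.isProbability
  have h1 : ∀ v, max 0 (v - c) - max 0 (v - r) =
      ∫ t in Ioc c r, (Iic v).indicator (fun _ => (1 : ℝ)) t := by
    intro v
    rw [setIntegral_indicator measurableSet_Iic, Ioc_inter_Iic]
    simp only [integral_const, MeasurableSet.univ, measureReal_restrict_apply, univ_inter,
      smul_eq_mul, mul_one, Real.volume_real_Ioc]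
    rcases le_total r v with h1 | h1 <;> rcases le_total c v with h2 | h2 <;>
      simp [h1, h2, hcr]
    all_goals linarith
  have h2 : Integrable (Function.uncurry fun v t => (Iic v).indicator (fun _ => (1 : ℝ)) t)
      (μ.prod (volume.restrict (Ioc c r))) := by
    have : (Function.uncurry fun v t => (Iic v).indicator (fun _ => (1 : ℝ)) t) =
        {p : ℝ × ℝ | p.2 ≤ p.1}.indicator fun _ => (1 : ℝ) := by
      ext ⟨v, t⟩; simp [indicator]
    rw [this]
    exact (integrable_const _).indicator (measurableSet_le measurable_snd measurable_fst)
  have h3 : ∫ v, (max 0 (v - c) - max 0 (v - r)) ∂μ = ∫ t in c..r, surv μ t := by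
    simp_rw [h1]
    rw [integral_integral_swap h2, intervalIntegral.integral_of_le hcr]
    congr 1 with t
    have : (fun v => (Iic v).indicator (fun _ => (1 : ℝ)) t) =
        (Ici t).indicator fun _ => (1 : ℝ) := by
      ext v; simp [indicator]
    rw [this, integral_indicator measurableSet_Ici]
    simp [surv]
  rw [integral_sub (h.integrable_of_continuous (by fun_prop))
    (h.integrable_of_continuous (by fun_prop))] at h3
  linarith

theorem integral_max_sub_eq_zero {c : ℝ} (hc : sSup μ.support ≤ c) :
    ∫ v, max 0 (v - c) ∂μ = 0 := by
  refine integral_eq_zero_of_ae ?_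
  filter_upwards [h.ae_mem_Icc] with v hv
  simpa using hv.2.trans hc

theorem integral_offer (c r : ℝ) :
    ∫ v, (v - c) * (if r ≤ v then 1 else 0) ∂μ =
      (r - c) * surv μ r + ∫ v, max 0 (v - r) ∂μ := by
  have := h.isProbability
  have h1 : ∀ v, (v - c) * (if r ≤ v then 1 else 0) =
      (Ici r).indicator (fun _ => r - c) v + max 0 (v - r) := by
    intro v
    by_cases hv : r ≤ v
    · simp [hv]
    · simp [hv, (not_le.1 hv).le]
  simp_rw [h1]
  rw [integral_add ((integrable_const _).indicator measurableSet_Ici)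
    (h.integrable_of_continuous (by fun_prop)), integral_indicator measurableSet_Ici]
  simp [surv, mul_comm]

/-- With a log-concave survival function, the gains from trade at an optimal price are at least
the fraction `1 / (e - 1)` of all gains from trade. -/
theorem integral_max_sub_le (hlc : IsLogConcaveSurv μ) {c r : ℝ} (hr : IsOptimalPrice μ c r) :
    ∫ v, max 0 (v - c) ∂μ ≤
      (Real.exp 1 - 1) * ∫ v, (v - c) * (if r ≤ v then 1 else 0) ∂μ := by
  have he := Real.add_one_le_exp 1
  have h1 : 0 ≤ ∫ v, max 0 (v - r) ∂μ := integral_nonneg fun _ => le_max_left _ _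
  rw [h.integral_offer]
  rcases le_or_gt (sSup μ.support) c with hc | hc
  · rw [h.integral_max_sub_eq_zero hc]
    exact mul_nonneg (by linarith) (add_nonneg hr.profit_nonneg h1)
  · rw [h.integral_max_sub (hr.cost_lt h hc).le]
    have := hr.intervalIntegral_surv_le h hlc hc
    nlinarith

theorem integral_max_sub_eq_zero_of_profit {c r : ℝ} (hr : IsOptimalPrice μ c r)
    (h0 : (r - c) * surv μ r = 0) : ∫ v, max 0 (v - c) ∂μ = 0 :=
  h.integral_max_sub_eq_zero (not_lt.1 fun hc => (hr.profit_pos h hc).ne' h0)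

end IsBoundedPrior

/-! ### Virtual surplus. -/

namespace IsBoundedPrior

variable (h : IsBoundedPrior μ)

include h

theorem surv_lt_surv (hlc : IsLogConcaveSurv μ) {t y : ℝ} (hat : sInf μ.support < t)
    (htV : t < sSup μ.support) (hty : t < y) : surv μ y < surv μ t := by
  obtain ⟨k, hk0, hk⟩ := hlc t htV
  have hpos := h.surv_pos htV
  -- Slope 0 would give 1 = S(a) ≤ S(t) with `a` the bottom of the support, but S is below 1 to the
  -- right of `a`.
  have hk1 : 0 < k := by
    refine hk0.lt_of_ne fun h0 => ?_
    have h1 := hk (sInf μ.support)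
    rw [← h0, h.surv_eq_one le_rfl] at h1
    simp only [zero_mul, Real.exp_zero, mul_one] at h1
    exact absurd (h.surv_lt_one hat) (not_lt.2 h1)
  have h2 : Real.exp (k * (t - y)) < 1 := (Real.exp_lt_exp.2 (show k * (t - y) < 0 by nlinarith)).trans_eq Real.exp_zero
  nlinarith [hk y]

/-- Strict decrease rules out gaps. Incentive constraints are imposed only on the support, while the
payment identity needs them on an interval. -/
theorem Icc_subset_support (hlc : IsLogConcaveSurv μ) :
    Icc (sInf μ.support) (sSup μ.support) ⊆ μ.support := by
  have := h.isProbability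
  intro t ht
  rcases ht.1.eq_or_lt with h1 | h1
  · exact h1 ▸ h.sInf_mem
  rcases ht.2.eq_or_lt with h2 | h2
  · exact h2 ▸ h.sSup_mem
  rw [Measure.mem_support_iff_forall]
  intro U hU
  obtain ⟨l, u, hlu, hU⟩ := mem_nhds_iff_exists_Ioo_subset.1 hU
  obtain ⟨y, hty, hyu⟩ := exists_between hlu.2
  have h3 := surv_sub_surv (μ := μ) hty.le
  have h4 := h.surv_lt_surv hlc h1 h2 hty
  have h5 : 0 < μ.real (Ico t y) := by linarith
  refine (ENNReal.toReal_pos_iff.1 h5).1.trans_le (measure_mono fun s hs => hU ?_)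
  exact ⟨hlu.1.trans_le hs.1, hs.2.trans hyu⟩

/-- S(s)exp(ks) is maximal at `t`, so its derivative vanishes there: the slope of any supporting
exponential is the hazard rate. -/
theorem ae_density_slope :
    ∀ᵐ t, t < sSup μ.support → ∀ k, (∀ s, surv μ s ≤ surv μ t * Real.exp (k * (t - s))) →
      density μ t = k * surv μ t := by
  filter_upwards [h.ae_hasDerivAt_surv] with t ht htV k hk
  have hd : HasDerivAt (fun t => Real.exp (k * t)) (Real.exp (k * t) * k) t := by
    simpa using ((hasDerivAt_id t).const_mul k).exp
  have hmax : IsLocalMax (fun s => surv μ s * Real.exp (k * s)) t := by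
    refine Eventually.of_forall fun s => ?_
    have h1 := hk s
    rwa [mul_sub, Real.exp_sub, mul_div_assoc', le_div_iff₀ (Real.exp_pos _)] at h1
  have h1 := hmax.hasDerivAt_eq_zero ((ht htV).mul hd)
  have h2 := Real.exp_pos (k * t)
  have h3 : (k * surv μ t - density μ t) * Real.exp (k * t) = 0 := by linarith
  rcases mul_eq_zero.1 h3 with h4 | h4 <;> linarith

/-- Below the optimal price the virtual value is at most the cost, above it is at least the
cost. -/
theorem ae_virtual_mul_nonpos (hlc : IsLogConcaveSurv μ) {c r : ℝ} (hr : IsOptimalPrice μ c r)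
    (hc : c < sSup μ.support) :
    ∀ᵐ t, t < sSup μ.support → (density μ t * (t - c) - surv μ t) * (r - t) ≤ 0 := by
  filter_upwards [h.ae_density_slope] with t ht htV
  rcases le_or_gt t c with htc | hct
  · have h0 : 0 ≤ density μ t := ENNReal.toReal_nonneg
    have h1 := surv_nonneg (μ := μ) t
    have h2 := hr.cost_lt h hc
    refine mul_nonpos_of_nonpos_of_nonneg ?_ (by linarith)
    nlinarith
  · obtain ⟨k, -, hk⟩ := hlc t htV
    have h1 := hr.slope_mul_nonpos h hct htV hk
    rw [ht htV k hk]
    nlinarith [surv_nonneg (μ := μ) t]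

theorem integral_eq_density {g : ℝ → ℝ} (hg : Integrable g μ) :
    ∫ v, g v ∂μ = (∫ t in Ioo (sInf μ.support) (sSup μ.support), density μ t * g t) +
      μ.real {sSup μ.support} * g (sSup μ.support) := by
  have := h.isProbability
  rw [h.setIntegral_density g measurableSet_Ioo fun t ht => ht.2,
    ← integral_add_compl (measurableSet_singleton (sSup μ.support)) hg, add_comm]
  congr 1
  · refine setIntegral_congr_set ?_
    -- The bottom carries no mass unless it is also the top, the case of a point mass.
    have h1 : ∀ᵐ v ∂μ, v = sInf μ.support → v = sSup μ.support := by
      rcases eq_or_ne (sInf μ.support) (sSup μ.support) with h2 | h2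
      · exact Eventually.of_forall fun v hv => hv.trans h2
      · have h3 := h.absolutelyContinuous (Real.volume_singleton (a := sInf μ.support))
        rw [Measure.restrict_apply (measurableSet_singleton _), inter_eq_left.2
          (singleton_subset_iff.2 h2)] at h3
        filter_upwards [measure_eq_zero_iff_ae_notMem.1 h3] with v hv hv' using absurd hv' hv
    filter_upwards [h.ae_mem_Icc, h1] with v hv hv1
    refine propext ⟨fun hV => ⟨hv.1.lt_of_ne fun h0 => hV (hv1 h0.symm), hv.2.lt_of_ne hV⟩,
      fun hV => hV.2.ne⟩
  · rw [integral_singleton, smul_eq_mul]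

theorem integral_max_sub_eq {r : ℝ} (har : sInf μ.support ≤ r) (hrV : r ≤ sSup μ.support) :
    ∫ v, max 0 (v - r) ∂μ = ∫ t in Ioo (sInf μ.support) (sSup μ.support),
      (if r ≤ t then 1 else 0) * surv μ t := by
  rw [h.integral_max_sub hrV, h.integral_max_sub_eq_zero le_rfl, zero_add,
    intervalIntegral.integral_of_le hrV]
  have h1 : (fun t => (if r ≤ t then 1 else 0) * surv μ t) = (Ici r).indicator (surv μ) := by
    ext t; simp [indicator]
  rw [h1, setIntegral_indicator measurableSet_Ici]
  refine setIntegral_congr_set ?_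
  have h2 : ∀ x : ℝ, ∀ᵐ t : ℝ, t ≠ x := fun x =>
    measure_eq_zero_iff_ae_notMem.1 (Real.volume_singleton (a := x))
  filter_upwards [h2 r, h2 (sSup μ.support)] with t h3 h4
  refine propext ⟨fun ht => ⟨⟨har.trans_lt ht.1, ht.2.lt_of_ne h4⟩, ht.1.le⟩,
    fun ht => ⟨lt_of_le_of_ne ht.2 h3.symm, ht.1.2.le⟩⟩

theorem integrableOn_mul_surv {x : ℝ → ℝ} (hx : Measurable x) (hx01 : ∀ v, x v ∈ Icc (0 : ℝ) 1)
    (a b : ℝ) : IntegrableOn (fun t => x t * surv μ t) (Ioo a b) := by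
  have := h.isProbability
  have hm : Measurable fun t => x t * surv μ t := hx.mul measurable_surv
  refine Integrable.of_bound hm.aestronglyMeasurable 1 (Eventually.of_forall fun t => ?_)
  rw [Real.norm_of_nonneg (mul_nonneg (hx01 t).1 (surv_nonneg t))]
  exact mul_le_one₀ (hx01 t).2 (surv_nonneg t) (surv_le_one t)

theorem integrable_sub_mul {x : ℝ → ℝ} (hx : Measurable x) (hx01 : ∀ v, x v ∈ Icc (0 : ℝ) 1)
    (c : ℝ) : Integrable (fun v => (v - c) * x v) μ := by
  refine (h.integrable_of_continuous (g := fun v => v - c) (by fun_prop)).mul_bdd (c := 1)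
    hx.aestronglyMeasurable (Eventually.of_forall fun t => ?_)
  rw [Real.norm_of_nonneg (hx01 t).1]
  exact (hx01 t).2

/-- For every allocation rule, the virtual surplus is at most the profit at the optimal price. -/
theorem virtual_surplus_le (hlc : IsLogConcaveSurv μ) {c r : ℝ} (hr : IsOptimalPrice μ c r)
    {x : ℝ → ℝ} (hx : Measurable x) (hx01 : ∀ v, x v ∈ Icc (0 : ℝ) 1) :
    ∫ v, (v - c) * x v ∂μ - ∫ t in Ioo (sInf μ.support) (sSup μ.support), x t * surv μ t ≤
      (r - c) * surv μ r := by
  have := h.isProbability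
  rcases le_or_gt (sSup μ.support) c with hc | hc
  · have h1 : ∫ v, (v - c) * x v ∂μ ≤ 0 := by
      refine integral_nonpos_of_ae ?_
      filter_upwards [h.ae_mem_Icc] with v hv
      exact mul_nonpos_of_nonpos_of_nonneg (by linarith [hv.2]) (hx01 v).1
    have h2 : 0 ≤ ∫ t in Ioo (sInf μ.support) (sSup μ.support), x t * surv μ t :=
      integral_nonneg fun t => mul_nonneg (hx01 t).1 (surv_nonneg t)
    linarith [hr.profit_nonneg]
  have hrV := hr.le_sSup h hc
  set i : ℝ → ℝ := fun t => if r ≤ t then 1 else 0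
  have hi : Measurable i := Measurable.ite measurableSet_Ici measurable_const measurable_const
  have hi01 : ∀ v, i v ∈ Icc (0 : ℝ) 1 := fun v => by
    simp only [i]; split_ifs <;> simp
  have hval : ∫ v, (v - c) * i v ∂μ -
      ∫ t in Ioo (sInf μ.support) (sSup μ.support), i t * surv μ t = (r - c) * surv μ r := by
    simp only [i]
    rw [h.integral_offer, h.integral_max_sub_eq (hr.sInf_le h) hrV]
    ring
  rw [← hval]
  -- The virtual surplus is linear in the allocation rule, with weight f(t)(t - c) - S(t) inside the
  -- support, f being `density μ`, and Pr[v = V](V - c) at the top V. The weight has the right sign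
  -- on either side of `r`, so the indicator of t ≥ r maximizes it pointwise.
  have hdec : ∀ {y : ℝ → ℝ}, Measurable y → (∀ v, y v ∈ Icc (0 : ℝ) 1) →
      IntegrableOn (fun t => (density μ t * (t - c) - surv μ t) * y t)
        (Ioo (sInf μ.support) (sSup μ.support)) ∧
      ∫ v, (v - c) * y v ∂μ -
        ∫ t in Ioo (sInf μ.support) (sSup μ.support), y t * surv μ t =
      (∫ t in Ioo (sInf μ.support) (sSup μ.support),
        (density μ t * (t - c) - surv μ t) * y t) +
      μ.real {sSup μ.support} * ((sSup μ.support - c) * y (sSup μ.support)) := by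
    intro y hy hy01
    have h1 := h.integrable_sub_mul hy hy01 c
    have h2 := h.integrableOn_density_mul (s := Ioo (sInf μ.support) (sSup μ.support))
      measurableSet_Ioo h1.integrableOn
    have h3 := h.integrableOn_mul_surv hy hy01 (sInf μ.support) (sSup μ.support)
    have h4 : (fun t => (density μ t * (t - c) - surv μ t) * y t) =
      fun t => density μ t * ((t - c) * y t) - y t * surv μ t := by ext t; ring
    rw [h4]
    refine ⟨h2.sub h3, ?_⟩
    rw [integral_sub h2 h3, h.integral_eq_density h1]
    ring
  rw [(hdec hx hx01).2, (hdec hi hi01).2]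
  refine add_le_add ?_ ?_
  · refine setIntegral_mono_on_ae (hdec hx hx01).1 (hdec hi hi01).1 measurableSet_Ioo ?_
    filter_upwards [h.ae_virtual_mul_nonpos hlc hr hc,
      measure_eq_zero_iff_ae_notMem.1 (Real.volume_singleton (a := r))] with t ht htr htI
    have h1 := ht htI.2
    have h2 := hx01 t
    rcases lt_or_gt_of_ne (show t ≠ r from htr) with h3 | h3
    · have h4 : i t = 0 := by simp [i, h3]
      have h5 : density μ t * (t - c) - surv μ t ≤ 0 := nonpos_of_mul_nonpos_left h1 (by linarith)
      rw [h4, mul_zero]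
      exact mul_nonpos_of_nonpos_of_nonneg h5 h2.1
    · have h4 : i t = 1 := by simp [i, h3.le]
      have h5 : 0 ≤ density μ t * (t - c) - surv μ t := by
        by_contra! h6
        exact absurd (mul_pos_of_neg_of_neg h6 (sub_neg.2 h3)) (not_lt.2 h1)
      rw [h4]
      exact mul_le_mul_of_nonneg_left h2.2 h5
  · have h4 : i (sSup μ.support) = 1 := by simp [i, hrV]
    rw [h4]
    have h5 : 0 ≤ sSup μ.support - c := by linarith
    exact mul_le_mul_of_nonneg_left (mul_le_mul_of_nonneg_left (hx01 _).2 h5) measureReal_nonneg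

end IsBoundedPrior

/-! ### Information rents and the revenue bound. -/

/-- The payment identity as an inequality: under incentive compatibility and individual
rationality at the lowest value, the information rent is at least the integral of the allocation
rule. -/
theorem payment_le {X P : ℝ → ℝ} {a b : ℝ} (hX : ∀ v, X v ∈ Icc (0 : ℝ) 1)
    (hIC : ∀ v ∈ Icc a b, ∀ v' ∈ Icc a b, v * X v' - P v' ≤ v * X v - P v)
    (hIR : 0 ≤ a * X a - P a) {v : ℝ} (hv : v ∈ Icc a b) :
    P v ≤ v * X v - ∫ t in a..v, X t := by
  have hmono : MonotoneOn X (Icc a b) := by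
    intro s hs t ht hst
    rcases hst.eq_or_lt with rfl | hst
    · exact le_rfl
    · have h1 := hIC s hs t ht
      have h2 := hIC t ht s hs
      nlinarith
  have hsub : Icc a v ⊆ Icc a b := Icc_subset_Icc_right hv.2
  set u : ℝ → ℝ := fun t => t * X t - P t
  have hcont : ContinuousOn u (Icc a v) := by
    refine (LipschitzOnWith.of_dist_le_mul (K := 1) fun s hs t ht => ?_).continuousOn
    have h1 := hIC s (hsub hs) t (hsub ht)
    have h2 := hIC t (hsub ht) s (hsub hs)
    have h3 := hX s
    have h4 := hX t
    rw [NNReal.coe_one, one_mul, Real.dist_eq, Real.dist_eq, abs_le]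
    simp only [u]
    rcases le_total s t with hst | hst
    · rw [abs_of_nonpos (by linarith)]
      constructor <;> nlinarith [h3.1, h3.2, h4.1, h4.2]
    · rw [abs_of_nonneg (by linarith)]
      constructor <;> nlinarith [h3.1, h3.2, h4.1, h4.2]
  -- Incentive compatibility squeezes u(s) - u(t) between (s - t)X(t) and (s - t)X(s), so u' = X
  -- wherever X is continuous. As X is monotone, only countably many points are lost.
  have hderiv : ∀ t ∈ Ioo a v \ {x ∈ Icc a b | ¬ContinuousWithinAt X (Icc a b) x},
      HasDerivAt u (X t) t := by
    rintro t ⟨ht, htc⟩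
    have htb : t ∈ Ioo a b := ⟨ht.1, ht.2.trans_le hv.2⟩
    have hc : ContinuousAt X t := by
      by_contra h0
      exact htc ⟨Ioo_subset_Icc_self htb, fun h1 => h0 (h1.continuousAt (Icc_mem_nhds htb.1 htb.2))⟩
    rw [hasDerivAt_iff_isLittleO, Asymptotics.isLittleO_iff]
    intro ε hε
    filter_upwards [Metric.continuousAt_iff'.1 hc ε hε, Icc_mem_nhds htb.1 htb.2] with s hs hsI
    have h1 := hIC s hsI t (Ioo_subset_Icc_self htb)
    have h2 := hIC t (Ioo_subset_Icc_self htb) s hsI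
    have h3 : 0 ≤ u s - u t - (s - t) * X t := by simp only [u]; linarith
    have h4 : u s - u t - (s - t) * X t ≤ (X s - X t) * (s - t) := by simp only [u]; linarith
    rw [smul_eq_mul, Real.norm_of_nonneg h3]
    refine h4.trans ((le_abs_self _).trans ?_)
    rw [abs_mul]
    exact mul_le_mul_of_nonneg_right hs.le (abs_nonneg _)
  have hint : IntervalIntegrable X volume a v := by
    refine MonotoneOn.intervalIntegrable ?_
    rw [uIcc_of_le hv.1]
    exact hmono.mono hsub
  rw [integral_eq_of_hasDerivAt_off_countable_of_le u X hv.1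
    hmono.countable_not_continuousWithinAt hcont hderiv hint]
  simp only [u]
  linarith

namespace IsBoundedPrior

variable (h : IsBoundedPrior μ)

include h

theorem integral_integral_eq {X : ℝ → ℝ} (hX : Measurable X) (hX01 : ∀ v, X v ∈ Icc (0 : ℝ) 1) :
    Integrable (fun v => ∫ t in sInf μ.support..v, X t) μ ∧
    ∫ v, (∫ t in sInf μ.support..v, X t) ∂μ =
      ∫ t in Ioo (sInf μ.support) (sSup μ.support), X t * surv μ t := by
  have := h.isProbability
  have h1 : ∀ᵐ v ∂μ, ∫ t in sInf μ.support..v, X t =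
      ∫ t in Ioo (sInf μ.support) (sSup μ.support), (Iic v).indicator X t := by
    filter_upwards [h.ae_mem_Icc] with v hv
    rw [← integral_Ioc_eq_integral_Ioo, setIntegral_indicator measurableSet_Iic, Ioc_inter_Iic,
      min_eq_right hv.2, intervalIntegral.integral_of_le hv.1]
  have h2 : Integrable (Function.uncurry fun v t => (Iic v).indicator X t)
      (μ.prod (volume.restrict (Ioo (sInf μ.support) (sSup μ.support)))) := by
    have : (Function.uncurry fun v t => (Iic v).indicator X t) =
        {p : ℝ × ℝ | p.2 ≤ p.1}.indicator fun p => X p.2 := by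
      ext ⟨v, t⟩; simp [indicator]
    rw [this]
    refine Integrable.indicator ?_ (measurableSet_le measurable_snd measurable_fst)
    refine Integrable.of_bound (hX.comp measurable_snd).aestronglyMeasurable 1
      (Eventually.of_forall fun p => ?_)
    rw [Real.norm_of_nonneg (hX01 _).1]
    exact (hX01 _).2
  refine ⟨h2.integral_prod_left.congr (h1.mono fun v hv => hv.symm), ?_⟩
  rw [integral_congr_ae h1, integral_integral_swap h2]
  congr 1 with t
  have : (fun v => (Iic v).indicator X t) = (Ici t).indicator fun _ => X t := by
    ext v; simp [indicator]
  rw [this, integral_indicator measurableSet_Ici]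
  simp [surv, mul_comm]

theorem profit_le (p c : ℝ) : (p - c) * surv μ p ≤ |sSup μ.support - c| := by
  have := h.isProbability
  rcases le_or_gt p (sSup μ.support) with h1 | h1
  · rcases le_total p c with h2 | h2
    · exact (mul_nonpos_of_nonpos_of_nonneg (by linarith) (surv_nonneg p)).trans (abs_nonneg _)
    · refine (mul_le_of_le_one_right (by linarith) (surv_le_one p)).trans ?_
      exact (by linarith : p - c ≤ sSup μ.support - c).trans (le_abs_self _)
  · simp [h.surv_eq_zero h1]

/-- The optimal profit is nonnegative and bounded by the distance from the cost to the top of the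
support. -/
theorem integrable_profit {ν : Measure ℝ} [IsFiniteMeasure ν] (hν : Integrable (fun c => c) ν)
    {r : ℝ → ℝ} (hr : Measurable r) (hopt : ∀ᵐ c ∂ν, IsOptimalPrice μ c (r c)) :
    Integrable (fun c => (r c - c) * surv μ (r c)) ν := by
  have := h.isProbability
  refine ((integrable_const (sSup μ.support)).sub hν).abs.mono'
    ((hr.sub measurable_id).mul (measurable_surv.comp hr)).aestronglyMeasurable ?_
  filter_upwards [hopt] with c hc
  rw [Real.norm_of_nonneg hc.profit_nonneg]
  exact h.profit_le _ _

/-- The expected payment collected by an incentive compatible and individually rational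
mechanism, net of the expected cost, is at most the expected profit from optimal prices. -/
theorem revenue_le (hlc : IsLogConcaveSurv μ) {ν : Measure ℝ} [IsProbabilityMeasure ν]
    (hν : Integrable (fun c => c) ν) {x : ℝ → ℝ → ℝ} (hx : Measurable (Function.uncurry x))
    (hx01 : ∀ v c, x v c ∈ Icc (0 : ℝ) 1) {P : ℝ → ℝ} (hP : Integrable P μ)
    (hIC : ∀ v ∈ μ.support, ∀ v' ∈ μ.support,
      v * ∫ c, x v' c ∂ν - P v' ≤ v * ∫ c, x v c ∂ν - P v)
    (hIR : ∀ v ∈ μ.support, 0 ≤ v * ∫ c, x v c ∂ν - P v)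
    {r : ℝ → ℝ} (hr : Measurable r) (hopt : ∀ᵐ c ∂ν, IsOptimalPrice μ c (r c)) :
    ∫ v, P v ∂μ - ∫ z, z.2 * x z.1 z.2 ∂(μ.prod ν) ≤ ∫ c, (r c - c) * surv μ (r c) ∂ν := by
  have := h.isProbability
  set a := sInf μ.support
  set V := sSup μ.support
  set X : ℝ → ℝ := fun v => ∫ c, x v c ∂ν
  have hXm : Measurable X := hx.stronglyMeasurable.integral_prod_right.measurable
  have hxv : ∀ v, Integrable (fun c => x v c) ν := fun v => by
    refine Integrable.of_bound (hx.comp measurable_prodMk_left).aestronglyMeasurable 1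
      (Eventually.of_forall fun c => ?_)
    rw [Real.norm_of_nonneg (hx01 _ _).1]
    exact (hx01 _ _).2
  have hX01 : ∀ v, X v ∈ Icc (0 : ℝ) 1 := fun v =>
    ⟨integral_nonneg fun c => (hx01 v c).1, by
      simpa using integral_mono (hxv v) (integrable_const 1) fun c => (hx01 v c).2⟩
  have hxbd : ∀ᵐ z ∂μ.prod ν, ‖x z.1 z.2‖ ≤ 1 := Eventually.of_forall fun z => by
    rw [Real.norm_of_nonneg (hx01 _ _).1]
    exact (hx01 _ _).2
  have hvx : Integrable (fun z : ℝ × ℝ => z.1 * x z.1 z.2) (μ.prod ν) :=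
    ((h.integrable_of_continuous continuous_id).comp_fst ν).mul_bdd hx.aestronglyMeasurable hxbd
  have hcx : Integrable (fun z : ℝ × ℝ => z.2 * x z.1 z.2) (μ.prod ν) :=
    (hν.comp_snd μ).mul_bdd hx.aestronglyMeasurable hxbd
  have hxs : Integrable (Function.uncurry fun t c => x t c * surv μ t)
      ((volume.restrict (Ioo a V)).prod ν) := by
    refine Integrable.of_bound
      (hx.mul (measurable_surv.comp measurable_fst)).aestronglyMeasurable 1
      (Eventually.of_forall fun z => ?_)
    have := mul_nonneg (hx01 z.1 z.2).1 (surv_nonneg (μ := μ) z.1)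
    simp only [Function.uncurry]
    rw [Real.norm_of_nonneg this]
    exact mul_le_one₀ (hx01 _ _).2 (surv_nonneg _) (surv_le_one _)
  -- The rent is charged in the interim, averaged over `c`. Fubini below moves it to each fixed `c`,
  -- where the single-cost bound applies.
  have h1 : ∫ v, P v ∂μ ≤ ∫ v, v * X v ∂μ - ∫ t in Ioo a V, X t * surv μ t := by
    obtain ⟨h2, h3⟩ := h.integral_integral_eq hXm hX01
    have h4 : Integrable (fun v => v * X v) μ := by
      simpa using h.integrable_sub_mul hXm hX01 0
    rw [← h3, ← integral_sub h4 h2]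
    refine integral_mono_ae hP (h4.sub h2) ?_
    have hsupp := h.Icc_subset_support hlc
    filter_upwards [h.ae_mem_Icc] with v hv
    exact payment_le hX01 (fun v hv v' hv' => hIC v (hsupp hv) v' (hsupp hv'))
      (hIR _ h.sInf_mem) hv
  have h2 : ∫ v, v * X v ∂μ = ∫ z, z.1 * x z.1 z.2 ∂(μ.prod ν) := by
    rw [integral_prod _ hvx]
    simp only [X, integral_const_mul]
  have h3 : ∫ t in Ioo a V, X t * surv μ t = ∫ c, (∫ t in Ioo a V, x t c * surv μ t) ∂ν := by
    rw [← integral_integral_swap hxs]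
    simp only [X, integral_mul_const]
  have hvc : Integrable (fun z : ℝ × ℝ => (z.1 - z.2) * x z.1 z.2) (μ.prod ν) :=
    (hvx.sub hcx).congr (Eventually.of_forall fun z => (sub_mul _ _ _).symm)
  have h4 : ∫ z, z.1 * x z.1 z.2 ∂(μ.prod ν) - ∫ z, z.2 * x z.1 z.2 ∂(μ.prod ν) =
      ∫ c, ∫ v, (v - c) * x v c ∂μ ∂ν := by
    rw [← integral_sub hvx hcx, ← integral_prod_symm _ hvc]
    simp only [sub_mul]
  have h5 : Integrable (fun c => ∫ v, (v - c) * x v c ∂μ) ν := hvc.integral_prod_right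
  have h7 : Integrable (fun c => ∫ t in Ioo a V, x t c * surv μ t) ν := hxs.integral_prod_right
  have h6 : ∫ c, ∫ v, (v - c) * x v c ∂μ ∂ν - ∫ c, (∫ t in Ioo a V, x t c * surv μ t) ∂ν ≤
      ∫ c, (r c - c) * surv μ (r c) ∂ν := by
    rw [← integral_sub h5 h7]
    refine integral_mono_ae (h5.sub h7)
      (h.integrable_profit hν hr hopt) ?_
    filter_upwards [hopt] with c hc
    exact h.virtual_surplus_le hlc hc (x := fun v => x v c) (hx.comp measurable_prodMk_right)
      fun v => hx01 v c
  linarith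

end IsBoundedPrior

/-! ### Existence of optimal prices -/

/-- Adding the two optimality inequalities gives S(r') ≤ S(r). If r' < r, the sale probabilities
would then coincide, and the higher price would be strictly better at cost `c'`. Monotonicity makes
any selection of optimal prices measurable. -/
theorem IsOptimalPrice.mono (h : IsBoundedPrior μ) {c c' r r' : ℝ} (hr : IsOptimalPrice μ c r)
    (hr' : IsOptimalPrice μ c' r') (hc : c < c') (hc' : c' < sSup μ.support) : r ≤ r' := by
  have := h.isProbability
  by_contra! hlt
  have h1 := hr r'
  have h2 := hr' r
  have h3 : surv μ r ≤ surv μ r' := surv_antitone hlt.le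
  have h4 := hr'.surv_pos h hc'
  have h5 : surv μ r = surv μ r' := by nlinarith
  rw [h5] at h2
  have := le_of_mul_le_mul_right h2 h4
  linarith

namespace IsBoundedPrior

variable (h : IsBoundedPrior μ)

include h

theorem exists_isOptimalPrice {c : ℝ} (hc : c < sSup μ.support) : ∃ r, IsOptimalPrice μ c r := by
  have hcont : ContinuousOn (fun p => (p - c) * surv μ p) (Icc c (sSup μ.support)) :=
    (by fun_prop : Continuous fun p : ℝ => p - c).continuousOn.mul
      (h.continuousOn_surv.mono Icc_subset_Iic_self)
  obtain ⟨r, hr, hmax⟩ := isCompact_Icc.exists_isMaxOn (nonempty_Icc.2 hc.le) hcont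
  have h0 : 0 ≤ (r - c) * surv μ r := mul_nonneg (sub_nonneg.2 hr.1) (surv_nonneg r)
  refine ⟨r, fun p => ?_⟩
  rcases lt_or_ge p c with hp | hp
  · exact (mul_nonpos_of_nonpos_of_nonneg (by linarith) (surv_nonneg p)).trans h0
  rcases le_or_gt p (sSup μ.support) with hp' | hp'
  · exact hmax ⟨hp, hp'⟩
  · rwa [h.surv_eq_zero hp', mul_zero]

/-- There is a monotone choice of optimal prices. -/
theorem exists_monotone_isOptimalPrice :
    ∃ r : ℝ → ℝ, Monotone r ∧ ∀ c, IsOptimalPrice μ c (r c) ∧ c ≤ r c := by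
  classical
  choose r hr using fun c : {c // c < sSup μ.support} => h.exists_isOptimalPrice c.2
  -- At costs from the top upwards the best profit is 0. The price c + 1 exceeds the top, so it
  -- never sells, and it keeps the selection monotone.
  refine ⟨fun c => if hc : c < sSup μ.support then r ⟨c, hc⟩ else c + 1, ?_, ?_⟩
  · intro c c' hcc'
    rcases hcc'.eq_or_lt with rfl | hcc'
    · exact le_rfl
    by_cases hc' : c' < sSup μ.support
    · have hc := hcc'.trans hc'
      simp only [hc, hc', dif_pos]
      exact (hr ⟨c, hc⟩).mono h (hr ⟨c', hc'⟩) hcc' hc'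
    · by_cases hc : c < sSup μ.support
      · simp only [hc, hc', dif_pos, dif_neg, not_false_eq_true]
        linarith [(hr ⟨c, hc⟩).le_sSup h hc, not_lt.1 hc']
      · simp only [hc, hc', dif_neg, not_false_eq_true]
        linarith
  · intro c
    by_cases hc : c < sSup μ.support
    · simp only [hc, dif_pos]
      exact ⟨hr ⟨c, hc⟩, ((hr ⟨c, hc⟩).cost_lt h hc).le⟩
    · simp only [hc, dif_neg, not_false_eq_true]
      refine ⟨fun p => ?_, by linarith⟩
      rw [h.surv_eq_zero (by linarith [not_lt.1 hc] : sSup μ.support < c + 1), mul_zero]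
      rcases le_or_gt p (sSup μ.support) with hp | hp
      · exact mul_nonpos_of_nonpos_of_nonneg (by linarith [not_lt.1 hc]) (surv_nonneg p)
      · simp [h.surv_eq_zero hp]

end IsBoundedPrior

/-! ### Reflection -/

theorem measurableEmbedding_subLeft (C : ℝ) : MeasurableEmbedding fun c => C - c :=
  (Homeomorph.subLeft C).measurableEmbedding

theorem integral_reflect (μ : Measure ℝ) (C : ℝ) (g : ℝ → ℝ) :
    ∫ w, g w ∂(μ.map fun c => C - c) = ∫ c, g (C - c) ∂μ :=
  (measurableEmbedding_subLeft C).integral_map g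

theorem mem_support_reflect {C w : ℝ} :
    w ∈ (μ.map fun c => C - c).support ↔ C - w ∈ μ.support := by
  simp only [Measure.mem_support_iff_forall, (measurableEmbedding_subLeft C).map_apply]
  have hcont : ∀ t : ℝ, ContinuousAt (fun c : ℝ => C - c) t := fun t => by fun_prop
  constructor
  · intro h U hU
    have := h ((fun c => C - c) ⁻¹' U) (hcont w hU)
    simpa [← preimage_comp, Function.comp_def] using this
  · intro h U hU
    exact h _ (hcont (C - w) (by simpa using hU))

theorem surv_reflect (C t : ℝ) :
    surv (μ.map fun c => C - c) t = μ.real (Iic (C - t)) := by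
  rw [surv, measureReal_def, (measurableEmbedding_subLeft C).map_apply, measureReal_def]
  congr 2
  ext c
  simp only [mem_preimage, mem_Ici, mem_Iic]
  constructor <;> intro h <;> linarith

theorem IsBuyerPrior.isBoundedPrior {F : Measure ℝ} (h : IsBuyerPrior F) : IsBoundedPrior F where
  isProbability := h.isProbability
  bddBelow := ⟨0, fun _ hx => h.support_nonneg hx⟩
  bddAbove := h.support_bddAbove
  absolutelyContinuous := h.absolutelyContinuous

/-- Reflection moves the possible atom from the smallest value to the largest, the position required
of a bounded prior. -/
theorem IsSellerPrior.isBoundedPrior_reflect {G : Measure ℝ} (h : IsSellerPrior G) (C : ℝ) :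
    IsBoundedPrior (G.map fun c => C - c) := by
  have := h.isProbability
  have hsupp : (G.map fun c => C - c).support = (fun c => C - c) '' G.support := by
    ext w
    rw [mem_support_reflect]
    exact ⟨fun hw => ⟨_, hw, by ring⟩, fun ⟨c, hc, hw⟩ => by simpa [← hw] using hc⟩
  have hne : G.support.Nonempty := Measure.nonempty_support (IsProbabilityMeasure.ne_zero G)
  have hbelow : BddBelow G.support := ⟨0, fun _ hx => h.support_nonneg hx⟩
  have hanti : Antitone fun c : ℝ => C - c := fun _ _ h => sub_le_sub_left h C
  have hSup : sSup (G.map fun c => C - c).support = C - sInf G.support := by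
    rw [hsupp]
    exact (hanti.map_csInf_of_continuousAt (by fun_prop) hne hbelow).symm
  refine ⟨Measure.isProbabilityMeasure_map (by fun_prop), ?_, ?_, ?_⟩
  · rw [hsupp]; exact hanti.map_bddAbove h.support_bddAbove
  · rw [hsupp]; exact hanti.map_bddBelow hbelow
  · rw [hSup, (measurableEmbedding_subLeft C).restrict_map]
    have hpre : (fun c => C - c) ⁻¹' {C - sInf G.support}ᶜ = {sInf G.support}ᶜ := by
      ext c; simp
    rw [hpre]
    refine (h.absolutelyContinuous.map (measurableEmbedding_subLeft C).measurable).trans ?_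
    rw [(Measure.measurePreserving_sub_left volume C).map_eq]

variable {F G : Measure ℝ}

namespace IsBuyerPrior

variable (hF : IsBuyerPrior F)

include hF

theorem ae_nonneg : ∀ᵐ v ∂F, 0 ≤ v := by
  filter_upwards [Measure.support_mem_ae (μ := F)] with v hv using hF.support_nonneg hv

theorem integrable_id : Integrable (fun v => v) F :=
  hF.isBoundedPrior.integrable_of_continuous continuous_id

end IsBuyerPrior

namespace IsSellerPrior

variable (hG : IsSellerPrior G)

include hG

theorem ae_nonneg : ∀ᵐ c ∂G, 0 ≤ c := by
  filter_upwards [Measure.support_mem_ae (μ := G)] with c hc using hG.support_nonneg hc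

theorem integrable_id : Integrable (fun c => c) G := by
  have := hG.isProbability
  refine Integrable.of_bound measurable_id.aestronglyMeasurable (sSup G.support) ?_
  filter_upwards [Measure.support_mem_ae (μ := G)] with c hc
  rw [Real.norm_of_nonneg (hG.support_nonneg hc)]
  exact le_csSup hG.support_bddAbove hc

end IsSellerPrior

/-! ### Utilities and gains from trade of general mechanisms. -/

namespace Mechanism

variable (M N : Mechanism)

/-- The allocation rule, cut off to `[0, 1]` also at irrelevant reports. -/
def clampAlloc (v c : ℝ) : ℝ := max 0 (min 1 (M.alloc v c))

theorem clampAlloc_mem (v c : ℝ) : M.clampAlloc v c ∈ Icc (0 : ℝ) 1 :=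
  ⟨le_max_left _ _, max_le zero_le_one (min_le_left _ _)⟩

theorem clampAlloc_eq {v c : ℝ} (hv : 0 ≤ v) (hc : 0 ≤ c) : M.clampAlloc v c = M.alloc v c := by
  have h := M.alloc_mem v c hv hc
  rw [clampAlloc, min_eq_right h.2, max_eq_right h.1]

theorem norm_clampAlloc_le (v c : ℝ) : ‖M.clampAlloc v c‖ ≤ 1 := by
  rw [Real.norm_of_nonneg (M.clampAlloc_mem v c).1]
  exact (M.clampAlloc_mem v c).2

theorem measurable_clampAlloc : Measurable (Function.uncurry M.clampAlloc) :=
  measurable_const.max (measurable_const.min M.measurable_alloc)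

theorem integrable_clampAlloc_right [IsFiniteMeasure G] (v : ℝ) :
    Integrable (fun c => M.clampAlloc v c) G :=
  Integrable.of_bound (M.measurable_clampAlloc.comp measurable_prodMk_left).aestronglyMeasurable 1
    (Eventually.of_forall fun _ => M.norm_clampAlloc_le _ _)

theorem integrable_clampAlloc_left [IsFiniteMeasure F] (c : ℝ) :
    Integrable (fun v => M.clampAlloc v c) F :=
  Integrable.of_bound (M.measurable_clampAlloc.comp measurable_prodMk_right).aestronglyMeasurable 1
    (Eventually.of_forall fun _ => M.norm_clampAlloc_le _ _)

theorem integrable_fst_mul_clampAlloc (hF : IsBuyerPrior F) (hG : IsSellerPrior G) :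
    Integrable (fun z : ℝ × ℝ => z.1 * M.clampAlloc z.1 z.2) (F.prod G) := by
  have := hF.isProbability
  have := hG.isProbability
  exact (hF.integrable_id.comp_fst G).mul_bdd (c := 1) M.measurable_clampAlloc.aestronglyMeasurable
    (Eventually.of_forall fun _ => M.norm_clampAlloc_le _ _)

theorem integrable_snd_mul_clampAlloc (hF : IsBuyerPrior F) (hG : IsSellerPrior G) :
    Integrable (fun z : ℝ × ℝ => z.2 * M.clampAlloc z.1 z.2) (F.prod G) := by
  have := hF.isProbability
  have := hG.isProbability
  exact (hG.integrable_id.comp_snd F).mul_bdd (c := 1) M.measurable_clampAlloc.aestronglyMeasurable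
    (Eventually.of_forall fun _ => M.norm_clampAlloc_le _ _)

theorem ae_clampAlloc_eq (hF : IsBuyerPrior F) (hG : IsSellerPrior G) :
    ∀ᵐ z ∂F.prod G, M.clampAlloc z.1 z.2 = M.alloc z.1 z.2 := by
  have := hF.isProbability
  have := hG.isProbability
  filter_upwards [Measure.quasiMeasurePreserving_fst.ae hF.ae_nonneg,
    Measure.quasiMeasurePreserving_snd.ae hG.ae_nonneg] with z h1 h2
  exact M.clampAlloc_eq h1 h2

variable {M N}

theorem HasExpectedPayments.integrable_pay [SFinite G] (hM : M.HasExpectedPayments F G) :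
    Integrable (fun v => ∫ c, M.pay v c ∂G) F :=
  hM.pay_exAnte.integral_prod_left

theorem HasExpectedPayments.integrable_receive [SFinite F] [SFinite G]
    (hM : M.HasExpectedPayments F G) : Integrable (fun c => ∫ v, M.receive v c ∂F) G :=
  hM.receive_exAnte.integral_prod_right

theorem buyerInterim_eq (hG : IsSellerPrior G) (hM : M.HasExpectedPayments F G) (v : ℝ) {v' : ℝ}
    (hv' : 0 ≤ v') :
    M.buyerInterim G v v' = v * ∫ c, M.clampAlloc v' c ∂G - ∫ c, M.pay v' c ∂G := by
  have := hG.isProbability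
  rw [← integral_const_mul,
    ← integral_sub ((M.integrable_clampAlloc_right v').const_mul v) (hM.pay_interim v' hv')]
  refine integral_congr_ae ?_
  filter_upwards [hG.ae_nonneg] with c hc
  rw [M.clampAlloc_eq hv' hc]

theorem sellerInterim_eq (hF : IsBuyerPrior F) (hM : M.HasExpectedPayments F G) (c : ℝ) {c' : ℝ}
    (hc' : 0 ≤ c') :
    M.sellerInterim F c c' = ∫ v, M.receive v c' ∂F - c * ∫ v, M.clampAlloc v c' ∂F := by
  have := hF.isProbability
  rw [← integral_const_mul,
    ← integral_sub (hM.receive_interim c' hc') ((M.integrable_clampAlloc_left c').const_mul c)]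
  refine integral_congr_ae ?_
  filter_upwards [hF.ae_nonneg] with v hv
  rw [M.clampAlloc_eq hv hc']

theorem ae_buyerInterim_eq (hF : IsBuyerPrior F) (hG : IsSellerPrior G)
    (hM : M.HasExpectedPayments F G) :
    ∀ᵐ v ∂F, M.buyerInterim G v v = ∫ c, v * M.clampAlloc v c ∂G - ∫ c, M.pay v c ∂G := by
  filter_upwards [hF.ae_nonneg] with v hv
  rw [buyerInterim_eq hG hM v hv, integral_const_mul]

theorem ae_sellerInterim_eq (hF : IsBuyerPrior F) (hG : IsSellerPrior G)
    (hM : M.HasExpectedPayments F G) :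
    ∀ᵐ c ∂G, M.sellerInterim F c c =
      ∫ v, M.receive v c ∂F - ∫ v, c * M.clampAlloc v c ∂F := by
  filter_upwards [hG.ae_nonneg] with c hc
  rw [sellerInterim_eq hF hM c hc, integral_const_mul]

theorem integrable_buyerInterim (hF : IsBuyerPrior F) (hG : IsSellerPrior G)
    (hM : M.HasExpectedPayments F G) : Integrable (fun v => M.buyerInterim G v v) F := by
  have := hF.isProbability
  have := hG.isProbability
  exact ((M.integrable_fst_mul_clampAlloc hF hG).integral_prod_left.sub
    hM.pay_exAnte.integral_prod_left).congr
      ((ae_buyerInterim_eq hF hG hM).mono fun v hv => hv.symm)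

theorem integrable_sellerInterim (hF : IsBuyerPrior F) (hG : IsSellerPrior G)
    (hM : M.HasExpectedPayments F G) : Integrable (fun c => M.sellerInterim F c c) G := by
  have := hF.isProbability
  have := hG.isProbability
  exact (hM.receive_exAnte.integral_prod_right.sub
    (M.integrable_snd_mul_clampAlloc hF hG).integral_prod_right).congr
      ((ae_sellerInterim_eq hF hG hM).mono fun v hv => hv.symm)

theorem buyerUtility_eq (hF : IsBuyerPrior F) (hG : IsSellerPrior G)
    (hM : M.HasExpectedPayments F G) :
    M.buyerUtility F G = ∫ z, z.1 * M.clampAlloc z.1 z.2 ∂(F.prod G) -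
      ∫ v, ∫ c, M.pay v c ∂G ∂F := by
  have := hF.isProbability
  have := hG.isProbability
  rw [integral_prod _ (M.integrable_fst_mul_clampAlloc hF hG),
    ← integral_sub (f := fun v => ∫ c, v * M.clampAlloc v c ∂G)
      (M.integrable_fst_mul_clampAlloc hF hG).integral_prod_left hM.integrable_pay]
  exact integral_congr_ae (ae_buyerInterim_eq hF hG hM)

theorem sellerUtility_eq (hF : IsBuyerPrior F) (hG : IsSellerPrior G)
    (hM : M.HasExpectedPayments F G) :
    M.sellerUtility F G = ∫ c, ∫ v, M.receive v c ∂F ∂G -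
      ∫ z, z.2 * M.clampAlloc z.1 z.2 ∂(F.prod G) := by
  have := hF.isProbability
  have := hG.isProbability
  rw [integral_prod_symm _ (M.integrable_snd_mul_clampAlloc hF hG),
    ← integral_sub (g := fun c => ∫ v, c * M.clampAlloc v c ∂F) hM.integrable_receive
      (M.integrable_snd_mul_clampAlloc hF hG).integral_prod_right]
  exact integral_congr_ae (ae_sellerInterim_eq hF hG hM)

theorem integrable_gft (M : Mechanism) (hF : IsBuyerPrior F) (hG : IsSellerPrior G) :
    Integrable (fun z : ℝ × ℝ => (z.1 - z.2) * M.alloc z.1 z.2) (F.prod G) := by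
  refine ((M.integrable_fst_mul_clampAlloc hF hG).sub
    (M.integrable_snd_mul_clampAlloc hF hG)).congr ?_
  filter_upwards [M.ae_clampAlloc_eq hF hG] with z hz
  rw [Pi.sub_apply, hz, sub_mul]

theorem integrable_optFB (hF : IsBuyerPrior F) (hG : IsSellerPrior G) :
    Integrable (fun z : ℝ × ℝ => max 0 (z.1 - z.2)) (F.prod G) := by
  have := hF.isProbability
  have := hG.isProbability
  exact (integrable_const 0).sup ((hF.integrable_id.comp_fst G).sub (hG.integrable_id.comp_snd F))

theorem gft_le_optFB (M : Mechanism) (hF : IsBuyerPrior F) (hG : IsSellerPrior G) :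
    M.gft F G ≤ optFB F G := by
  refine integral_mono_ae (M.integrable_gft hF hG) (integrable_optFB hF hG) ?_
  filter_upwards [M.ae_clampAlloc_eq hF hG] with z hz
  have h1 := M.clampAlloc_mem z.1 z.2
  rw [← hz]
  rcases le_total z.1 z.2 with h | h
  · exact (mul_nonpos_of_nonpos_of_nonneg (by linarith) h1.1).trans (le_max_left _ _)
  · exact (mul_le_of_le_one_right (by linarith) h1.2).trans (le_max_right _ _)

/-- The slack is the expected budget surplus E[p] - E[p̃]. -/
theorem utility_add_le_gft (hF : IsBuyerPrior F) (hG : IsSellerPrior G)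
    (hM : M ∈ admissible F G) :
    M.sellerUtility F G + M.buyerUtility F G ≤ M.gft F G := by
  have h1 : M.gft F G = ∫ z, z.1 * M.clampAlloc z.1 z.2 ∂(F.prod G) -
      ∫ z, z.2 * M.clampAlloc z.1 z.2 ∂(F.prod G) := by
    rw [← integral_sub (M.integrable_fst_mul_clampAlloc hF hG)
      (M.integrable_snd_mul_clampAlloc hF hG)]
    refine integral_congr_ae ?_
    filter_upwards [M.ae_clampAlloc_eq hF hG] with z hz
    rw [hz, sub_mul]
  have h2 : ∫ c, ∫ v, M.receive v c ∂F ∂G ≤ ∫ v, ∫ c, M.pay v c ∂G ∂F := hM.2.2.2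
  rw [sellerUtility_eq hF hG hM.1, buyerUtility_eq hF hG hM.1, h1]
  linarith

theorem buyerUtility_nonneg (hM : M ∈ admissible F G) : 0 ≤ M.buyerUtility F G := by
  refine integral_nonneg_of_ae ?_
  filter_upwards [Measure.support_mem_ae (μ := F)] with v hv using hM.2.2.1.buyer v hv

theorem sellerUtility_nonneg (hM : M ∈ admissible F G) : 0 ≤ M.sellerUtility F G := by
  refine integral_nonneg_of_ae ?_
  filter_upwards [Measure.support_mem_ae (μ := G)] with c hc using hM.2.2.1.seller c hc

/-! ### Mixtures -/

variable (t : unitInterval)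

theorem HasExpectedPayments.mix (hM : M.HasExpectedPayments F G) (hN : N.HasExpectedPayments F G) :
    (Mechanism.mix t M N).HasExpectedPayments F G where
  pay_interim v hv := ((hM.pay_interim v hv).const_mul _).add ((hN.pay_interim v hv).const_mul _)
  receive_interim c hc :=
    ((hM.receive_interim c hc).const_mul _).add ((hN.receive_interim c hc).const_mul _)
  pay_exAnte := (hM.pay_exAnte.const_mul _).add (hN.pay_exAnte.const_mul _)
  receive_exAnte := (hM.receive_exAnte.const_mul _).add (hN.receive_exAnte.const_mul _)

theorem buyerInterim_integrable (hG : IsSellerPrior G) (hM : M.HasExpectedPayments F G) (v : ℝ)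
    {v' : ℝ} (hv' : 0 ≤ v') : Integrable (fun c => v * M.alloc v' c - M.pay v' c) G := by
  have := hG.isProbability
  refine Integrable.sub (((M.integrable_clampAlloc_right v').congr ?_).const_mul v)
    (hM.pay_interim v' hv')
  filter_upwards [hG.ae_nonneg] with c hc using M.clampAlloc_eq hv' hc

theorem sellerInterim_integrable (hF : IsBuyerPrior F) (hM : M.HasExpectedPayments F G) (c : ℝ)
    {c' : ℝ} (hc' : 0 ≤ c') : Integrable (fun v => M.receive v c' - c * M.alloc v c') F := by
  have := hF.isProbability
  refine Integrable.sub (hM.receive_interim c' hc')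
    (((M.integrable_clampAlloc_left c').congr ?_).const_mul c)
  filter_upwards [hF.ae_nonneg] with v hv using M.clampAlloc_eq hv hc'

theorem buyerInterim_mix (hG : IsSellerPrior G) (hM : M.HasExpectedPayments F G)
    (hN : N.HasExpectedPayments F G) (v : ℝ) {v' : ℝ} (hv' : 0 ≤ v') :
    (Mechanism.mix t M N).buyerInterim G v v' =
      t * M.buyerInterim G v v' + (1 - t) * N.buyerInterim G v v' := by
  rw [buyerInterim, buyerInterim, buyerInterim, ← integral_const_mul, ← integral_const_mul,
    ← integral_add ((buyerInterim_integrable hG hM v hv').const_mul _)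
      ((buyerInterim_integrable hG hN v hv').const_mul _)]
  congr 1 with c
  simp only [Mechanism.mix]
  ring

theorem sellerInterim_mix (hF : IsBuyerPrior F) (hM : M.HasExpectedPayments F G)
    (hN : N.HasExpectedPayments F G) (c : ℝ) {c' : ℝ} (hc' : 0 ≤ c') :
    (Mechanism.mix t M N).sellerInterim F c c' =
      t * M.sellerInterim F c c' + (1 - t) * N.sellerInterim F c c' := by
  rw [sellerInterim, sellerInterim, sellerInterim, ← integral_const_mul, ← integral_const_mul,
    ← integral_add ((sellerInterim_integrable hF hM c hc').const_mul _)
      ((sellerInterim_integrable hF hN c hc').const_mul _)]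
  congr 1 with v
  simp only [Mechanism.mix]
  ring

theorem buyerUtility_mix (hF : IsBuyerPrior F) (hG : IsSellerPrior G)
    (hM : M.HasExpectedPayments F G) (hN : N.HasExpectedPayments F G) :
    (Mechanism.mix t M N).buyerUtility F G =
      t * M.buyerUtility F G + (1 - t) * N.buyerUtility F G := by
  rw [buyerUtility, buyerUtility, buyerUtility, ← integral_const_mul, ← integral_const_mul,
    ← integral_add ((integrable_buyerInterim hF hG hM).const_mul _)
      ((integrable_buyerInterim hF hG hN).const_mul _)]
  refine integral_congr_ae ?_
  filter_upwards [hF.ae_nonneg] with v hv using buyerInterim_mix t hG hM hN v hv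

theorem sellerUtility_mix (hF : IsBuyerPrior F) (hG : IsSellerPrior G)
    (hM : M.HasExpectedPayments F G) (hN : N.HasExpectedPayments F G) :
    (Mechanism.mix t M N).sellerUtility F G =
      t * M.sellerUtility F G + (1 - t) * N.sellerUtility F G := by
  rw [sellerUtility, sellerUtility, sellerUtility, ← integral_const_mul, ← integral_const_mul,
    ← integral_add ((integrable_sellerInterim hF hG hM).const_mul _)
      ((integrable_sellerInterim hF hG hN).const_mul _)]
  refine integral_congr_ae ?_
  filter_upwards [hG.ae_nonneg] with c hc using sellerInterim_mix t hF hM hN c hc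

theorem gft_mix (hF : IsBuyerPrior F) (hG : IsSellerPrior G) :
    (Mechanism.mix t M N).gft F G = t * M.gft F G + (1 - t) * N.gft F G := by
  rw [gft, gft, gft, ← integral_const_mul, ← integral_const_mul,
    ← integral_add ((M.integrable_gft hF hG).const_mul _) ((N.integrable_gft hF hG).const_mul _)]
  congr 1 with z
  simp only [Mechanism.mix]
  ring

theorem mix_mem_admissible (hF : IsBuyerPrior F) (hG : IsSellerPrior G)
    (hM : M ∈ admissible F G) (hN : N ∈ admissible F G) :
    Mechanism.mix t M N ∈ admissible F G := by
  have := hF.isProbability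
  have := hG.isProbability
  obtain ⟨hM1, hM2, hM3, hM4⟩ := hM
  obtain ⟨hN1, hN2, hN3, hN4⟩ := hN
  have ht0 : (0 : ℝ) ≤ t := t.2.1
  have ht1 : 0 ≤ 1 - (t : ℝ) := sub_nonneg.2 t.2.2
  refine ⟨hM1.mix t hN1, ⟨fun v hv v' hv' => ?_, fun c hc c' hc' => ?_⟩,
    ⟨fun v hv => ?_, fun c hc => ?_⟩, ?_⟩
  · rw [buyerInterim_mix t hG hM1 hN1 v hv', buyerInterim_mix t hG hM1 hN1 v (hF.support_nonneg hv)]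
    exact add_le_add (mul_le_mul_of_nonneg_left (hM2.buyer v hv v' hv') ht0)
      (mul_le_mul_of_nonneg_left (hN2.buyer v hv v' hv') ht1)
  · rw [sellerInterim_mix t hF hM1 hN1 c hc',
      sellerInterim_mix t hF hM1 hN1 c (hG.support_nonneg hc)]
    exact add_le_add (mul_le_mul_of_nonneg_left (hM2.seller c hc c' hc') ht0)
      (mul_le_mul_of_nonneg_left (hN2.seller c hc c' hc') ht1)
  · rw [buyerInterim_mix t hG hM1 hN1 v (hF.support_nonneg hv)]
    exact add_nonneg (mul_nonneg ht0 (hM3.buyer v hv)) (mul_nonneg ht1 (hN3.buyer v hv))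
  · rw [sellerInterim_mix t hF hM1 hN1 c (hG.support_nonneg hc)]
    exact add_nonneg (mul_nonneg ht0 (hM3.seller c hc)) (mul_nonneg ht1 (hN3.seller c hc))
  · have h1 : ∫ v, ∫ c, (Mechanism.mix t M N).pay v c ∂G ∂F =
        t * ∫ v, ∫ c, M.pay v c ∂G ∂F + (1 - t) * ∫ v, ∫ c, N.pay v c ∂G ∂F := by
      rw [← integral_const_mul, ← integral_const_mul,
        ← integral_add (hM1.integrable_pay.const_mul _)
          (hN1.integrable_pay.const_mul _)]
      refine integral_congr_ae ?_
      filter_upwards [hF.ae_nonneg] with v hv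
      simp only [Mechanism.mix]
      rw [integral_add ((hM1.pay_interim v hv).const_mul _) ((hN1.pay_interim v hv).const_mul _),
        integral_const_mul, integral_const_mul]
    have h2 : ∫ c, ∫ v, (Mechanism.mix t M N).receive v c ∂F ∂G =
        t * ∫ c, ∫ v, M.receive v c ∂F ∂G + (1 - t) * ∫ c, ∫ v, N.receive v c ∂F ∂G := by
      rw [← integral_const_mul, ← integral_const_mul,
        ← integral_add (hM1.integrable_receive.const_mul _)
          (hN1.integrable_receive.const_mul _)]
      refine integral_congr_ae ?_
      filter_upwards [hG.ae_nonneg] with c hc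
      simp only [Mechanism.mix]
      rw [integral_add ((hM1.receive_interim c hc).const_mul _)
        ((hN1.receive_interim c hc).const_mul _), integral_const_mul, integral_const_mul]
    rw [IsWBB, h1, h2]
    exact add_le_add (mul_le_mul_of_nonneg_left hM4 ht0) (mul_le_mul_of_nonneg_left hN4 ht1)

end Mechanism

/-! ### The Seller Offer Mechanism -/

namespace SellerOffer

variable (s : SellerOffer F G) (hF : IsBuyerPrior F) (hG : IsSellerPrior G)

-- Negative prices are below cost, so they cannot beat the profit 0 of posting the cost itself.
include hG in
theorem isOptimalPrice {c : ℝ} (hc : c ∈ G.support) : IsOptimalPrice F c (s.price c) := by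
  have hc0 : 0 ≤ c := hG.support_nonneg hc
  have h1 : ∀ p, 0 ≤ p → (p - c) * surv F p ≤ (s.price c - c) * surv F (s.price c) :=
    fun p hp => s.optimal c hc hp
  intro p
  rcases lt_or_ge p 0 with hp | hp
  · have h2 := h1 c hc0
    rw [sub_self, zero_mul] at h2
    exact (mul_nonpos_of_nonpos_of_nonneg (by linarith) (surv_nonneg p)).trans h2
  · exact h1 p hp

include hG in
theorem ae_isOptimalPrice : ∀ᵐ c ∂G, IsOptimalPrice F c (s.price c) := by
  filter_upwards [Measure.support_mem_ae (μ := G)] with c hc using s.isOptimalPrice hG hc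

/-- A buyer never accepts more than her value, so payments are integrable without any bound on the
posted prices. -/
theorem norm_pay_le {v c : ℝ} (hv : 0 ≤ v) (hc : 0 ≤ c) : ‖s.mechanism.pay v c‖ ≤ v := by
  rw [Real.norm_of_nonneg (s.mechanism.pay_nonneg v c hv hc)]
  simp only [mechanism]
  split_ifs with h
  exacts [h, hv]

include hF hG

theorem hasExpectedPayments : s.mechanism.HasExpectedPayments F G := by
  have := hF.isProbability
  have := hG.isProbability
  have hexAnte : Integrable (Function.uncurry s.mechanism.pay) (F.prod G) := by
    refine (hF.integrable_id.comp_fst G).mono' s.mechanism.measurable_pay.aestronglyMeasurable ?_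
    filter_upwards [Measure.quasiMeasurePreserving_fst.ae hF.ae_nonneg,
      Measure.quasiMeasurePreserving_snd.ae hG.ae_nonneg] with z h1 h2 using s.norm_pay_le h1 h2
  refine ⟨fun v hv => ?_, fun c hc => ?_, hexAnte, hexAnte⟩
  · refine Integrable.of_bound
      (s.mechanism.measurable_pay.comp measurable_prodMk_left).aestronglyMeasurable v ?_
    filter_upwards [hG.ae_nonneg] with c hc using s.norm_pay_le hv hc
  · refine hF.integrable_id.mono'
      (s.mechanism.measurable_receive.comp measurable_prodMk_right).aestronglyMeasurable ?_
    filter_upwards [hF.ae_nonneg] with v hv using s.norm_pay_le hv hc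

omit hG in
theorem sellerInterim_mechanism (c c' : ℝ) :
    s.mechanism.sellerInterim F c c' = (s.price c' - c) * surv F (s.price c') := by
  have := hF.isProbability
  have h1 : ∀ v, s.mechanism.receive v c' - c * s.mechanism.alloc v c' =
      (Ici (s.price c')).indicator (fun _ => s.price c' - c) v := by
    intro v
    by_cases hv : s.price c' ≤ v <;> simp [mechanism, hv]
  simp only [Mechanism.sellerInterim, h1]
  rw [integral_indicator measurableSet_Ici]
  simp [surv, mul_comm]

theorem mechanism_mem_admissible : s.mechanism ∈ admissible F G := by
  have := hF.isProbability
  have := hG.isProbability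
  have hM := s.hasExpectedPayments hF hG
  refine ⟨hM, ⟨fun v hv v' hv' => ?_, fun c hc c' hc' => ?_⟩, ⟨fun v hv => ?_, fun c hc => ?_⟩, ?_⟩
  -- A posted price is strategy-proof for the responder: truth is best against every `c` separately.
  · refine integral_mono (Mechanism.buyerInterim_integrable hG hM v hv')
      (Mechanism.buyerInterim_integrable hG hM v (hF.support_nonneg hv)) fun c => ?_
    simp only [mechanism]
    split_ifs <;> linarith
  · rw [s.sellerInterim_mechanism hF, s.sellerInterim_mechanism hF]
    exact s.isOptimalPrice hG hc _
  · refine integral_nonneg fun c => ?_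
    simp only [mechanism, Pi.zero_apply]
    split_ifs <;> linarith
  · rw [s.sellerInterim_mechanism hF]
    exact (s.isOptimalPrice hG hc).profit_nonneg
  · exact (integral_integral_swap hM.pay_exAnte).ge

omit hG in
theorem sellerUtility_mechanism : s.mechanism.sellerUtility F G =
    ∫ c, (s.price c - c) * surv F (s.price c) ∂G := by
  simp only [Mechanism.sellerUtility, s.sellerInterim_mechanism hF]

/-- No admissible mechanism is better for the seller. -/
theorem sellerUtility_le (hlc : IsLogConcaveSurv F) {M : Mechanism} (hM : M ∈ admissible F G) :
    M.sellerUtility F G ≤ s.mechanism.sellerUtility F G := by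
  have := hF.isProbability
  have := hG.isProbability
  obtain ⟨h1, h2, h3, h4⟩ := hM
  have key := hF.isBoundedPrior.revenue_le hlc hG.integrable_id M.measurable_clampAlloc
    M.clampAlloc_mem h1.integrable_pay
    (fun v hv v' hv' => by
      have h := h2.buyer v hv v' (hF.support_nonneg hv')
      rwa [Mechanism.buyerInterim_eq hG h1 v (hF.support_nonneg hv'),
        Mechanism.buyerInterim_eq hG h1 v (hF.support_nonneg hv)] at h)
    (fun v hv => by
      have h := h3.buyer v hv
      rwa [Mechanism.buyerInterim_eq hG h1 v (hF.support_nonneg hv)] at h)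
    s.measurable_price (s.ae_isOptimalPrice hG)
  have h5 : ∫ c, ∫ v, M.receive v c ∂F ∂G ≤ ∫ v, ∫ c, M.pay v c ∂G ∂F := h4
  rw [s.sellerUtility_mechanism hF, Mechanism.sellerUtility_eq hF hG h1]
  linarith

theorem sellerIdeal_eq (hlc : IsLogConcaveSurv F) :
    sellerIdeal F G = s.mechanism.sellerUtility F G :=
  IsGreatest.csSup_eq ⟨mem_image_of_mem _ (s.mechanism_mem_admissible hF hG), by
    rintro _ ⟨M, hM, rfl⟩
    exact s.sellerUtility_le hF hG hlc hM⟩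

theorem optFB_le (hlc : IsLogConcaveSurv F) :
    optFB F G ≤ (Real.exp 1 - 1) * s.mechanism.gft F G := by
  have := hF.isProbability
  have := hG.isProbability
  have h1 := Mechanism.integrable_optFB hF hG
  have h2 := s.mechanism.integrable_gft hF hG
  rw [optFB, Mechanism.gft, integral_prod_symm _ h1, integral_prod_symm _ h2,
    ← integral_const_mul]
  refine integral_mono_ae h1.integral_prod_right (h2.integral_prod_right.const_mul _) ?_
  filter_upwards [s.ae_isOptimalPrice hG] with c hc
  exact hF.isBoundedPrior.integral_max_sub_le hlc hc

/-- Every cost below the top value yields positive optimal profit, so zero expected profit means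
that almost every cost is at or above the top. -/
theorem optFB_eq_zero (h0 : s.mechanism.sellerUtility F G = 0) : optFB F G = 0 := by
  have := hF.isProbability
  have := hG.isProbability
  have hopt := s.ae_isOptimalPrice hG
  rw [s.sellerUtility_mechanism hF, integral_eq_zero_iff_of_nonneg_ae
    (hopt.mono fun c hc => hc.profit_nonneg) (hF.isBoundedPrior.integrable_profit
      hG.integrable_id s.measurable_price hopt)] at h0
  rw [optFB, integral_prod_symm _ (Mechanism.integrable_optFB hF hG)]
  refine integral_eq_zero_of_ae ?_
  filter_upwards [hopt, h0] with c hc hc0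
  exact hF.isBoundedPrior.integral_max_sub_eq_zero_of_profit hc hc0

omit hG in
theorem nonempty : Nonempty (SellerOffer F G) := by
  obtain ⟨r, hr, hopt⟩ := hF.isBoundedPrior.exists_monotone_isOptimalPrice
  exact ⟨⟨r, hr.measurable, fun c hc => hc.trans (hopt c).2, fun c _ p _ => (hopt c).1 p⟩⟩

end SellerOffer

/-! ### The Buyer Offer Mechanism -/

theorem integral_prod_reflect [SFinite F] [SFinite G] (C : ℝ) (f : ℝ → ℝ → ℝ) :
    ∫ z, f z.1 z.2 ∂((G.map fun c => C - c).prod (F.map fun c => C - c)) =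
      ∫ z, f (C - z.2) (C - z.1) ∂(F.prod G) := by
  have he := measurableEmbedding_subLeft C
  rw [Measure.map_prod_map _ _ he.measurable he.measurable, (he.prodMap he).integral_map]
  exact integral_prod_swap (μ := F) (ν := G) fun z => f (C - z.2) (C - z.1)

namespace BuyerOffer

variable (b : BuyerOffer F G) (hF : IsBuyerPrior F) (hG : IsSellerPrior G)

include hF hG

omit hF in
theorem real_Iic_eq_zero {p : ℝ} (hp : p < 0) : G.real (Iic p) = 0 := by
  have : G (Iic p) = 0 := by
    rw [measure_eq_zero_iff_ae_notMem]
    filter_upwards [hG.ae_nonneg] with c hc hcp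
    exact absurd (hc.trans hcp) (not_le.2 hp)
  simp [measureReal_def, this]

omit hG in
theorem profit_nonneg {v : ℝ} (hv : v ∈ F.support) :
    0 ≤ (v - b.price v) * G.real (Iic (b.price v)) := by
  simpa using b.optimal v hv (hF.support_nonneg hv)

theorem isOptimalPrice (C : ℝ) {v : ℝ} (hv : v ∈ F.support) :
    IsOptimalPrice (G.map fun c => C - c) (C - v) (C - b.price v) := by
  intro p
  rw [surv_reflect, surv_reflect, sub_sub_cancel]
  have h1 : C - b.price v - (C - v) = v - b.price v := by ring
  have h2 : p - (C - v) = v - (C - p) := by ring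
  rw [h1, h2]
  rcases lt_or_ge (C - p) 0 with hp | hp
  · rw [real_Iic_eq_zero hG hp, mul_zero]
    exact b.profit_nonneg hF hv
  · exact b.optimal v hv hp

theorem ae_isOptimalPrice (C : ℝ) : ∀ᵐ v ∂F,
    IsOptimalPrice (G.map fun c => C - c) (C - v) (C - b.price v) := by
  filter_upwards [Measure.support_mem_ae (μ := F)] with v hv using b.isOptimalPrice hF hG C hv

theorem ae_isOptimalPrice_reflect (C : ℝ) : ∀ᵐ k ∂(F.map fun v => C - v),
    IsOptimalPrice (G.map fun c => C - c) k (C - b.price (C - k)) := by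
  rw [(measurableEmbedding_subLeft C).ae_map_iff]
  simpa using b.ae_isOptimalPrice hF hG C

/-- A higher offer would be accepted with positive probability at a loss, whereas offering `v`
guarantees 0. This bound makes the payments integrable. -/
theorem price_le {v : ℝ} (hv : v ∈ F.support) : b.price v ≤ v + sSup G.support := by
  have := hG.isProbability
  by_contra! h
  have hne : G.support.Nonempty := Measure.nonempty_support (IsProbabilityMeasure.ne_zero G)
  obtain ⟨c, hc⟩ := hne
  have hcS := le_csSup hG.support_bddAbove hc
  have h0 := hG.support_nonneg hc
  have h1 := hF.support_nonneg hv
  rw [mem_Ici] at h0 h1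
  have h2 := (Measure.mem_support_iff_forall _).1 hc (Iic (b.price v)) (Iic_mem_nhds (by linarith))
  have h3 : 0 < G.real (Iic (b.price v)) := ENNReal.toReal_pos h2.ne' (measure_ne_top _ _)
  have h4 := b.profit_nonneg hF hv
  nlinarith

omit hF hG in
theorem norm_pay_le {v c : ℝ} (hv : 0 ≤ v) (hc : 0 ≤ c) :
    ‖b.mechanism.pay v c‖ ≤ b.price v := by
  rw [Real.norm_of_nonneg (b.mechanism.pay_nonneg v c hv hc)]
  simp only [mechanism]
  split_ifs
  exacts [le_rfl, b.price_nonneg v hv]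

theorem integrable_price : Integrable b.price F := by
  have := hF.isProbability
  refine (hF.integrable_id.add (integrable_const (sSup G.support))).mono'
    b.measurable_price.aestronglyMeasurable ?_
  filter_upwards [Measure.support_mem_ae (μ := F)] with v hv
  rw [Real.norm_of_nonneg (b.price_nonneg v (hF.support_nonneg hv))]
  exact b.price_le hF hG hv

theorem hasExpectedPayments : b.mechanism.HasExpectedPayments F G := by
  have := hF.isProbability
  have := hG.isProbability
  have hexAnte : Integrable (Function.uncurry b.mechanism.pay) (F.prod G) := by
    refine ((b.integrable_price hF hG).comp_fst G).mono'
      b.mechanism.measurable_pay.aestronglyMeasurable ?_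
    filter_upwards [Measure.quasiMeasurePreserving_fst.ae hF.ae_nonneg,
      Measure.quasiMeasurePreserving_snd.ae hG.ae_nonneg] with z h1 h2 using b.norm_pay_le h1 h2
  refine ⟨fun v hv => ?_, fun c hc => ?_, hexAnte, hexAnte⟩
  · refine Integrable.of_bound
      (b.mechanism.measurable_pay.comp measurable_prodMk_left).aestronglyMeasurable (b.price v) ?_
    filter_upwards [hG.ae_nonneg] with c hc using b.norm_pay_le hv hc
  · refine (b.integrable_price hF hG).mono'
      (b.mechanism.measurable_receive.comp measurable_prodMk_right).aestronglyMeasurable ?_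
    filter_upwards [hF.ae_nonneg] with v hv using b.norm_pay_le hv hc

omit hF in
theorem buyerInterim_mechanism (v v' : ℝ) :
    b.mechanism.buyerInterim G v v' = (v - b.price v') * G.real (Iic (b.price v')) := by
  have := hG.isProbability
  have h1 : ∀ c, v * b.mechanism.alloc v' c - b.mechanism.pay v' c =
      (Iic (b.price v')).indicator (fun _ => v - b.price v') c := by
    intro c
    by_cases hc : c ≤ b.price v' <;> simp [mechanism, hc]
  simp only [Mechanism.buyerInterim, h1]
  rw [integral_indicator measurableSet_Iic]
  simp [mul_comm]

theorem mechanism_mem_admissible : b.mechanism ∈ admissible F G := by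
  have := hF.isProbability
  have := hG.isProbability
  have hM := b.hasExpectedPayments hF hG
  refine ⟨hM, ⟨fun v hv v' hv' => ?_, fun c hc c' hc' => ?_⟩, ⟨fun v hv => ?_, fun c hc => ?_⟩, ?_⟩
  · rw [b.buyerInterim_mechanism hG, b.buyerInterim_mechanism hG]
    exact b.optimal v hv (b.price_nonneg v' hv')
  · refine integral_mono (Mechanism.sellerInterim_integrable hF hM c hc')
      (Mechanism.sellerInterim_integrable hF hM c (hG.support_nonneg hc)) fun v => ?_
    simp only [mechanism]
    split_ifs <;> linarith
  · rw [b.buyerInterim_mechanism hG]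
    exact b.profit_nonneg hF hv
  · refine integral_nonneg fun v => ?_
    simp only [mechanism, Pi.zero_apply]
    split_ifs <;> linarith
  · exact (integral_integral_swap hM.pay_exAnte).ge

omit hF in
theorem buyerUtility_mechanism : b.mechanism.buyerUtility F G =
    ∫ v, (v - b.price v) * G.real (Iic (b.price v)) ∂F := by
  simp only [Mechanism.buyerUtility, b.buyerInterim_mechanism hG]

omit hF in
theorem buyerUtility_mechanism_reflect (C : ℝ) : b.mechanism.buyerUtility F G =
    ∫ k, (C - b.price (C - k) - k) * surv (G.map fun c => C - c) (C - b.price (C - k))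
      ∂(F.map fun v => C - v) := by
  rw [b.buyerUtility_mechanism hG, integral_reflect]
  congr 1 with v
  rw [surv_reflect, sub_sub_cancel, sub_sub_cancel]
  congr 1
  ring

/-- No admissible mechanism is better for the buyer. -/
theorem buyerUtility_le {C : ℝ} (hlc : IsLogConcaveSurv (G.map fun c => C - c)) {M : Mechanism}
    (hM : M ∈ admissible F G) : M.buyerUtility F G ≤ b.mechanism.buyerUtility F G := by
  have := hF.isProbability
  have := hG.isProbability
  have he := measurableEmbedding_subLeft C
  have : IsProbabilityMeasure (F.map fun v => C - v) :=
    Measure.isProbabilityMeasure_map he.measurable.aemeasurable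
  obtain ⟨h1, h2, h3, h4⟩ := hM
  have hG' := hG.isBoundedPrior_reflect C
  have hν : Integrable (fun k => k) (F.map fun v => C - v) :=
    he.integrable_map_iff.2 ((integrable_const C).sub hF.integrable_id)
  have hx : Measurable (Function.uncurry fun w k => M.clampAlloc (C - k) (C - w)) :=
    M.measurable_clampAlloc.comp (by fun_prop : Measurable fun z : ℝ × ℝ => (C - z.2, C - z.1))
  have hclamp : Integrable (fun z : ℝ × ℝ => M.clampAlloc z.1 z.2) (F.prod G) :=
    Integrable.of_bound M.measurable_clampAlloc.aestronglyMeasurable 1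
      (Eventually.of_forall fun _ => M.norm_clampAlloc_le _ _)
  have hX : Integrable (fun c => C * ∫ v, M.clampAlloc v c ∂F) G :=
    (hclamp.integral_prod_right (f := fun z => M.clampAlloc z.1 z.2)).const_mul C
  -- In the reflected market the seller with cost c = C - w acts as a buyer of value `w` whose
  -- payment is C times the allocation minus the receipt. Her utility there is the seller's utility,
  -- as `hrent` records.
  have hP : Integrable (fun w => C * ∫ v, M.clampAlloc v (C - w) ∂F -
      ∫ v, M.receive v (C - w) ∂F) (G.map fun c => C - c) := by
    rw [he.integrable_map_iff]
    refine (hX.sub h1.integrable_receive).congr (Eventually.of_forall fun c => ?_)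
    simp
  have hrent : ∀ w ∈ (G.map fun c => C - c).support, ∀ w' ∈ (G.map fun c => C - c).support,
      w * ∫ k, M.clampAlloc (C - k) (C - w') ∂(F.map fun v => C - v) -
        (C * ∫ v, M.clampAlloc v (C - w') ∂F - ∫ v, M.receive v (C - w') ∂F) =
      M.sellerInterim F (C - w) (C - w') := by
    intro w _ w' hw'
    rw [integral_reflect F C fun k => M.clampAlloc (C - k) (C - w'),
      Mechanism.sellerInterim_eq hF h1 _ (hG.support_nonneg (mem_support_reflect.1 hw'))]
    simp only [sub_sub_cancel]
    ring
  have key := hG'.revenue_le hlc hν hx (fun w k => M.clampAlloc_mem _ _) hP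
    (fun w hw w' hw' => by
      rw [hrent w hw w' hw', hrent w hw w hw]
      exact h2.seller _ (mem_support_reflect.1 hw) _
        (hG.support_nonneg (mem_support_reflect.1 hw')))
    (fun w hw => by
      rw [hrent w hw w hw]
      exact h3.seller _ (mem_support_reflect.1 hw))
    (r := fun k => C - b.price (C - k))
    ((b.measurable_price.comp he.measurable).const_sub C)
    (b.ae_isOptimalPrice_reflect hF hG C)
  rw [← b.buyerUtility_mechanism_reflect hG C, integral_reflect,
    integral_prod_reflect C fun w k => k * M.clampAlloc (C - k) (C - w)] at key
  simp only [sub_sub_cancel] at key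
  have h5 : ∫ c, (C * ∫ v, M.clampAlloc v c ∂F - ∫ v, M.receive v c ∂F) ∂G =
      C * ∫ z, M.clampAlloc z.1 z.2 ∂(F.prod G) - ∫ c, ∫ v, M.receive v c ∂F ∂G := by
    rw [integral_sub hX h1.integrable_receive, integral_const_mul, integral_prod_symm _ hclamp]
  have h6 : ∫ z, (C - z.1) * M.clampAlloc z.1 z.2 ∂(F.prod G) =
      C * ∫ z, M.clampAlloc z.1 z.2 ∂(F.prod G) -
        ∫ z, z.1 * M.clampAlloc z.1 z.2 ∂(F.prod G) := by
    rw [← integral_const_mul, ← integral_sub (hclamp.const_mul C)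
      (M.integrable_fst_mul_clampAlloc hF hG)]
    simp only [sub_mul]
  have h7 : ∫ c, ∫ v, M.receive v c ∂F ∂G ≤ ∫ v, ∫ c, M.pay v c ∂G ∂F := h4
  rw [Mechanism.buyerUtility_eq hF hG h1]
  rw [h5, h6] at key
  linarith

theorem buyerIdeal_eq {C : ℝ} (hlc : IsLogConcaveSurv (G.map fun c => C - c)) :
    buyerIdeal F G = b.mechanism.buyerUtility F G :=
  IsGreatest.csSup_eq ⟨mem_image_of_mem _ (b.mechanism_mem_admissible hF hG), by
    rintro _ ⟨M, hM, rfl⟩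
    exact b.buyerUtility_le hF hG hlc hM⟩

omit b hF hG in
theorem integral_max_reflect (C v : ℝ) :
    ∫ c, max 0 (v - c) ∂G = ∫ w, max 0 (w - (C - v)) ∂(G.map fun c => C - c) := by
  rw [integral_reflect G C fun w => max 0 (w - (C - v))]
  simp only [sub_sub_sub_cancel_left]

theorem optFB_le {C : ℝ} (hlc : IsLogConcaveSurv (G.map fun c => C - c)) :
    optFB F G ≤ (Real.exp 1 - 1) * b.mechanism.gft F G := by
  have := hF.isProbability
  have := hG.isProbability
  have h1 := Mechanism.integrable_optFB hF hG
  have h2 := b.mechanism.integrable_gft hF hG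
  rw [optFB, Mechanism.gft, integral_prod _ h1, integral_prod _ h2, ← integral_const_mul]
  refine integral_mono_ae h1.integral_prod_left (h2.integral_prod_left.const_mul _) ?_
  filter_upwards [b.ae_isOptimalPrice hF hG C] with v hv
  have h3 := (hG.isBoundedPrior_reflect C).integral_max_sub_le hlc hv
  rw [← integral_max_reflect, integral_reflect] at h3
  refine h3.trans_eq ?_
  simp only [sub_sub_sub_cancel_left, sub_le_sub_iff_left, mechanism]

theorem optFB_eq_zero (h0 : b.mechanism.buyerUtility F G = 0) : optFB F G = 0 := by
  have := hF.isProbability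
  have := hG.isProbability
  have he := measurableEmbedding_subLeft 0
  have : IsProbabilityMeasure (F.map fun v => 0 - v) :=
    Measure.isProbabilityMeasure_map he.measurable.aemeasurable
  have hG' := hG.isBoundedPrior_reflect 0
  have hopt := b.ae_isOptimalPrice_reflect hF hG 0
  have hν : Integrable (fun k => k) (F.map fun v => 0 - v) :=
    he.integrable_map_iff.2 ((integrable_const 0).sub hF.integrable_id)
  rw [b.buyerUtility_mechanism_reflect hG 0, integral_eq_zero_iff_of_nonneg_ae
    (hopt.mono fun c hc => hc.profit_nonneg) (hG'.integrable_profit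
      hν ((b.measurable_price.comp he.measurable).const_sub 0) hopt)] at h0
  rw [optFB, integral_prod _ (Mechanism.integrable_optFB hF hG)]
  refine integral_eq_zero_of_ae ?_
  have h1 := he.ae_map_iff.1 (hopt.and h0)
  filter_upwards [h1] with v hv
  have h2 := hG'.integral_max_sub_eq_zero_of_profit hv.1 hv.2
  rwa [← integral_max_reflect] at h2

theorem nonempty : Nonempty (BuyerOffer F G) := by
  obtain ⟨r, hr, hopt⟩ := (hG.isBoundedPrior_reflect 0).exists_monotone_isOptimalPrice
  -- Undoing the reflection may give a negative offer. Such an offer never trades and earns 0, so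
  -- cutting it off at 0 loses nothing.
  refine ⟨⟨fun v => max 0 (-r (-v)), ?_, fun v _ => le_max_left _ _, fun v hv p _ => ?_⟩⟩
  · exact measurable_const.max (hr.measurable.comp measurable_neg).neg
  · have h1 : ∀ p, (v - p) * G.real (Iic p) ≤ (v - -r (-v)) * G.real (Iic (-r (-v))) := by
      intro p
      have h2 := (hopt (-v)).1 (-p)
      rw [surv_reflect, surv_reflect, zero_sub, zero_sub, neg_neg] at h2
      convert h2 using 2 <;> ring
    have h0 := hF.support_nonneg hv
    rw [mem_Ici] at h0
    rcases le_or_gt 0 (-r (-v)) with h3 | h3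
    · simpa [h3] using h1 p
    · have h4 := h1 p
      rw [real_Iic_eq_zero hG h3, mul_zero] at h4
      refine h4.trans ?_
      simp only [max_eq_left h3.le, sub_zero]
      exact mul_nonneg h0 measureReal_nonneg

end BuyerOffer

/-! ### The biased random offer mechanism -/

/-- `A` and `D` stand for the seller's and the buyer's ideal utilities, `B` and `E` for what each
gets when the other side makes the offer. Cross-multiplying gives t(A(D - E) + D(A - B)) = D(A - B).
If the coefficient of t vanishes, then A = B and D = E, and both ratios are 1. -/
theorem exists_unitInterval_div_eq {A B D E : ℝ} (hA : 0 < A) (hD : 0 < D) (hBA : B ≤ A)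
    (hED : E ≤ D) :
    ∃ t : unitInterval, (t * A + (1 - t) * B) / A = (t * E + (1 - t) * D) / D := by
  have hp : 0 ≤ A * (D - E) := mul_nonneg hA.le (sub_nonneg.2 hED)
  have hq : 0 ≤ D * (A - B) := mul_nonneg hD.le (sub_nonneg.2 hBA)
  rcases (add_nonneg hp hq).eq_or_lt with h0 | h0
  · refine ⟨0, ?_⟩
    rw [div_eq_div_iff hA.ne' hD.ne']
    simp only [Set.Icc.coe_zero]
    nlinarith
  · refine ⟨⟨D * (A - B) / (A * (D - E) + D * (A - B)), by positivity,
      (div_le_one h0).2 (by linarith)⟩, ?_⟩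
    rw [div_eq_div_iff hA.ne' hD.ne']
    have := h0.ne'
    field_simp
    ring

end BilateralTrade

theorem mainTheorem7 (F G : MeasureTheory.Measure ℝ)
    (hF : IsBuyerPrior F) (hG : IsSellerPrior G)
    (hF' : IsBuyerMHR F) (hG' : IsSellerMHR G) :
    Nonempty (SellerOffer F G) ∧ Nonempty (BuyerOffer F G) ∧
      ∀ (s : SellerOffer F G) (b : BuyerOffer F G), ∃ t : unitInterval,
        IsKSFair (biasedRandomOffer t s b) F G ∧
          1 / (Real.exp 1 - 1) * optSB F G ≤ (biasedRandomOffer t s b).gft F G ∧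
          1 / (Real.exp 1 - 1) * optFB F G ≤ (biasedRandomOffer t s b).gft F G := by
  refine ⟨SellerOffer.nonempty hF, BuyerOffer.nonempty hF hG, fun s b => ?_⟩
  have hlcF := hF.isBoundedPrior.isLogConcaveSurv hF'
  have hlcG := (hG.isBoundedPrior_reflect (sSup G.support)).isLogConcaveSurv hG'
  have hs := s.mechanism_mem_admissible hF hG
  have hb := b.mechanism_mem_admissible hF hG
  have he : 0 < Real.exp 1 - 1 := by linarith [Real.add_one_le_exp 1]
  have hfair : ∃ t : unitInterval, IsKSFair (biasedRandomOffer t s b) F G := by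
    have hfb := s.mechanism.gft_le_optFB hF hG
    have hfb' := b.mechanism.gft_le_optFB hF hG
    have hsum := Mechanism.utility_add_le_gft hF hG hs
    have hsum' := Mechanism.utility_add_le_gft hF hG hb
    have hs1 := Mechanism.sellerUtility_nonneg hs
    have hs2 := Mechanism.buyerUtility_nonneg hs
    have hb1 := Mechanism.sellerUtility_nonneg hb
    have hb2 := Mechanism.buyerUtility_nonneg hb
    suffices ∃ t : unitInterval, (t * s.mechanism.sellerUtility F G +
        (1 - t) * b.mechanism.sellerUtility F G) / s.mechanism.sellerUtility F G =
        (t * s.mechanism.buyerUtility F G +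
        (1 - t) * b.mechanism.buyerUtility F G) / b.mechanism.buyerUtility F G by
      obtain ⟨t, ht⟩ := this
      refine ⟨t, Mechanism.mix_mem_admissible t hF hG hs hb, ?_⟩
      rw [biasedRandomOffer, Mechanism.sellerUtility_mix t hF hG hs.1 hb.1,
        Mechanism.buyerUtility_mix t hF hG hs.1 hb.1, s.sellerIdeal_eq hF hG hlcF,
        b.buyerIdeal_eq hF hG hlcG, ht]
    -- Without gains from trade both ideals are 0, and division by zero makes both ratios 0.
    -- Otherwise both ideals are positive.
    rcases eq_or_ne (optFB F G) 0 with h0 | h0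
    · have h1 : s.mechanism.sellerUtility F G = 0 := by linarith
      have h2 : b.mechanism.buyerUtility F G = 0 := by linarith
      exact ⟨0, by rw [h1, h2, div_zero, div_zero]⟩
    · exact exists_unitInterval_div_eq
        (hs1.lt_of_ne fun h => h0 (s.optFB_eq_zero hF hG h.symm))
        (hb2.lt_of_ne fun h => h0 (b.optFB_eq_zero hF hG h.symm))
        (s.sellerUtility_le hF hG hlcF hb) (b.buyerUtility_le hF hG hlcG hs)
  obtain ⟨t, ht⟩ := hfair
  have hgft : optFB F G ≤ (Real.exp 1 - 1) * (biasedRandomOffer t s b).gft F G := by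
    rw [biasedRandomOffer, Mechanism.gft_mix t hF hG]
    have h1 := mul_le_mul_of_nonneg_left (s.optFB_le hF hG hlcF) t.2.1
    have h2 := mul_le_mul_of_nonneg_left (b.optFB_le hF hG hlcG) (sub_nonneg.2 t.2.2)
    linarith
  have hSB : optSB F G ≤ optFB F G := csSup_le ⟨_, mem_image_of_mem _ hs⟩ (by
    rintro _ ⟨M, -, rfl⟩
    exact M.gft_le_optFB hF hG)
  refine ⟨t, ht, ?_, ?_⟩ <;> rw [one_div_mul_eq_div, div_le_iff₀' he]
  exacts [hSB.trans hgft, hgft]
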